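/- Let $n\ge 0$, let $M,N_0$ be positive integers, $\Sigma=\{1,\dots,M\}\subset\mathbb R$, let $C\subset\mathbb R^n$ be closed, and for each $\sigma\in\Sigma$ let $F_\sigma:\mathbb R^n\rightrightarrows\mathbb R^n$ be a set-valued map and $z^*_\sigma\in\mathbb R^n$ a point. Assume for each $\sigma\in\Sigma$: (a) $F_\sigma$ is outer semicontinuous and locally bounded relative to $C$, and $F_\sigma(z)$ is nonempty and convex for every $z\in C$; moreover $z^*_\sigma$ is globally asymptotically stable for $\dot z\in F_\sigma(z)$, $z\in C$. That is: for every $\varepsilon>0$ there is $\delta>0$ such that solutions starting within $\delta$ of $z^*_\sigma$ stay within $\varepsilon$ of it; and every solution, from any initial point, is bounded and, if complete, converges to $z^*_\sigma$ (solutions need be neither maximal nor complete). (b) The only solution of $\dot z\in -F_\sigma(z)$, $z\in C$, with $z(0)=z^*_\sigma$ is $z(t)=z^*_\sigma$ for all $t\ge 0$ (this constant function is a solution, and every solution from $z^*_\sigma$ agrees with it on its domain). Let $\hat{\mathcal H}_0$ be the hybrid system with state $(z,\sigma,\tau)\in\mathbb R^{n+2}$ that flows according to $\dot z\in F_\sigma(z)$,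 $\dot\sigma=0$, $\dot\tau=0$ on $C\times\Sigma\times[0,N_0]$ and jumps according to $z^+=z$, $\sigma^+\in\Sigma\setminus\{\sigma\}$, $\tau^+=\tau-1$ on $C\times\Sigma\times[1,N_0]$. Its solutions are understood in the usual sense: hybrid arcs on hybrid time domains, locally absolutely continuous along flows. For $K\subset\mathbb R^{n+2}$ let $R_0(K)$ be the set of all values $x(t,j)$, $(t,j)\in\operatorname{dom}x$, of solutions $x$ of $\hat{\mathcal H}_0$ with $x(0,0)\in K$, and let $\Omega_0(K)$ be the set of all limits $\lim_{i\to\infty}x_i(t_i,j_i)$ where each $x_i$ is a solution with $x_i(0,0)\in K$, $(t_i,j_i)\in\operatorname{dom}x_i$, and $t_i+j_i\to\infty$. With $\mathbb B$ the closed unit ball of $\mathbb R^n$, put $$S_\sigma=\bigcap_{j\ge 0}\overline{R_0\Big(\big(\{z^*_\sigma\}+\tfrac1{j+1}\mathbb B\big)\times\{\sigma\}\times[0,N_0]\Big)},\qquad S=\bigcup_{\sigma\in\Sigma}S_\sigma .$$ Then for every compact set $K\subset\mathbb R^{n+2}$ whose interior contains $\big(\bigcup_{\sigma\in\Sigma}\{z^*_\sigma\}\times\{\sigma\}\big)\times[0,N_0]$,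 $$\Omega_0(K)=S .$$ -/

import Mathlib

open Set Filter Topology MeasureTheory

/-- A hybrid inclusion `x ∈ C, ẋ ∈ F(x)`; `x ∈ D, x⁺ ∈ G(x)` on the state space `X`. -/
structure HybridSystem (X : Type*) where
  /-- flow set -/
  C : Set X
  /-- flow map -/
  F : X → Set X
  /-- jump set -/
  D : Set X
  /-- jump map -/
  G : X → Set X

/-- Compact hybrid time domains: `⋃_{j ≤ J} [t_j, t_{j+1}] × {j}` with `0 = t_0 ≤ t_1 ≤ ⋯`. -/
def IsCompactHybridTimeDomain (E : Set (ℝ × ℕ)) : Prop :=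
  ∃ (J : ℕ) (t : ℕ → ℝ), t 0 = 0 ∧ Monotone t ∧
    E = {p | p.2 ≤ J ∧ t p.2 ≤ p.1 ∧ p.1 ≤ t (p.2 + 1)}

/-- Hybrid time domains: (nonempty) sets all of whose truncations at their points are compact
hybrid time domains. -/
def IsHybridTimeDomain (E : Set (ℝ × ℕ)) : Prop :=
  E.Nonempty ∧
    ∀ p ∈ E, IsCompactHybridTimeDomain (E ∩ {q | 0 ≤ q.1 ∧ q.1 ≤ p.1 ∧ q.2 ≤ p.2})

/-- A hybrid arc: a function on a hybrid time domain that is locally absolutely continuous in `t`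
on each `I^j = {t | (t, j) ∈ dom}`. The values of `val` outside `dom` are irrelevant. -/
structure HybridArc (X : Type*) [PseudoMetricSpace X] where
  /-- the domain of the arc -/
  dom : Set (ℝ × ℕ)
  /-- the values of the arc -/
  val : ℝ → ℕ → X
  isHybridTimeDomain : IsHybridTimeDomain dom
  absolutelyContinuous : ∀ (j : ℕ) (a b : ℝ), a ≤ b → (∀ t ∈ Icc a b, (t, j) ∈ dom) →
    AbsolutelyContinuousOnInterval (fun t => val t j) a b

namespace HybridArc

variable {X : Type*} [PseudoMetricSpace X]

/-- The set `I^j` of times `t` with `(t, j) ∈ dom x`. -/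
def flowTimes (x : HybridArc X) (j : ℕ) : Set ℝ := {t | (t, j) ∈ x.dom}

/-- A complete arc: its domain is unbounded. -/
def IsComplete (x : HybridArc X) : Prop :=
  ∀ R : ℝ, ∃ t : ℝ, ∃ j : ℕ, (t, j) ∈ x.dom ∧ R ≤ t + j

/-- A bounded arc: its range is bounded. -/
def IsBounded (x : HybridArc X) : Prop :=
  Bornology.IsBounded {y | ∃ t : ℝ, ∃ j : ℕ, (t, j) ∈ x.dom ∧ y = x.val t j}

/-- `lim_{t + j → ∞} |x(t, j)|_A = 0` along the domain of `x`. -/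
def ConvergesTo (x : HybridArc X) (A : Set X) : Prop :=
  ∀ ε > 0, ∃ T : ℝ, ∀ (t : ℝ) (j : ℕ), (t, j) ∈ x.dom → T ≤ t + j →
    Metric.infDist (x.val t j) A < ε

end HybridArc

namespace HybridSystem

variable {X : Type*} [NormedAddCommGroup X] [NormedSpace ℝ X]

/-- Solutions of a hybrid system (not required to be maximal or complete). -/
structure IsSolution (H : HybridSystem X) (x : HybridArc X) : Prop where
  init : x.val 0 0 ∈ closure H.C ∪ H.D
  flow_mem : ∀ (j : ℕ), ∀ t ∈ interior (x.flowTimes j), x.val t j ∈ H.C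
  flow : ∀ (j : ℕ), ∀ᵐ t : ℝ, t ∈ interior (x.flowTimes j) →
    ∃ v ∈ H.F (x.val t j), HasDerivAt (fun s => x.val s j) v t
  jump : ∀ (t : ℝ) (j : ℕ), (t, j) ∈ x.dom → (t, j + 1) ∈ x.dom →
    x.val t j ∈ H.D ∧ x.val t (j + 1) ∈ H.G (x.val t j)

/-- `𝒮(K)`: the set of solutions that start in `K`. -/
def solutions (H : HybridSystem X) (K : Set X) : Set (HybridArc X) :=
  {x | H.IsSolution x ∧ x.val 0 0 ∈ K}

/-- The reachable set from `K`. -/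
def reachable (H : HybridSystem X) (K : Set X) : Set X :=
  {y | ∃ x ∈ H.solutions K, ∃ t : ℝ, ∃ j : ℕ, (t, j) ∈ x.dom ∧ x.val t j = y}

/-- The `Ω`-limit set from `K`: all limits of sequences `x_i(t_i, j_i)` where `x_i` is a solution
that starts in `K`, `(t_i, j_i) ∈ dom x_i` and `t_i + j_i → ∞`. -/
def omegaLimitSet (H : HybridSystem X) (K : Set X) : Set X :=
  {y | ∃ (x : ℕ → HybridArc X) (t : ℕ → ℝ) (j : ℕ → ℕ),
    (∀ i, x i ∈ H.solutions K ∧ (t i, j i) ∈ (x i).dom) ∧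
    Tendsto (fun i => t i + (j i : ℝ)) atTop atTop ∧
    Tendsto (fun i => (x i).val (t i) (j i)) atTop (𝓝 y)}

/-- Stability of the (compact) set `A`. -/
def IsStable (H : HybridSystem X) (A : Set X) : Prop :=
  ∀ ε > 0, ∃ δ > 0, ∀ x₀ : X, Metric.infDist x₀ A ≤ δ → ∀ x ∈ H.solutions {x₀},
    ∀ (t : ℝ) (j : ℕ), (t, j) ∈ x.dom → Metric.infDist (x.val t j) A ≤ ε

/-- The set of initial conditions from which every solution is bounded and, if complete,
converges to `A`. -/
def basinOfAttraction (H : HybridSystem X) (A : Set X) : Set X :=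
  {x₀ | ∀ x ∈ H.solutions {x₀}, x.IsBounded ∧ (x.IsComplete → x.ConvergesTo A)}

/-- Attractivity of the (compact) set `A`. -/
def IsAttractive (H : HybridSystem X) (A : Set X) : Prop :=
  ∃ δ > 0, Metric.cthickening δ A ⊆ H.basinOfAttraction A

/-- Global asymptotic stability of the (compact) set `A`. -/
def IsGloballyAsymptoticallyStable (H : HybridSystem X) (A : Set X) : Prop :=
  H.IsStable A ∧ H.IsAttractive A ∧ H.basinOfAttraction A = univ

end HybridSystem

/-- The constrained differential inclusion `z ∈ C, ż ∈ F(z)`, as a hybrid system without jumps. -/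
def constrainedInclusion {X : Type*} (C : Set X) (F : X → Set X) : HybridSystem X where
  C := C
  F := F
  D := ∅
  G := fun _ => ∅

/-- Outer semicontinuity of the set-valued map `F` relative to `C`. -/
def OuterSemicontinuousRel {X Y : Type*} [TopologicalSpace X] [TopologicalSpace Y]
    (F : X → Set Y) (C : Set X) : Prop :=
  ∀ (x : ℕ → X) (y : ℕ → Y) (x₀ : X) (y₀ : Y), x₀ ∈ C → (∀ i, x i ∈ C ∧ y i ∈ F (x i)) →
    Tendsto x atTop (𝓝 x₀) → Tendsto y atTop (𝓝 y₀) → y₀ ∈ F x₀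

/-- Local boundedness of the set-valued map `F` relative to `C`. -/
def LocallyBoundedRel {X Y : Type*} [TopologicalSpace X] [Bornology Y]
    (F : X → Set Y) (C : Set X) : Prop :=
  ∀ x ∈ C, ∃ U ∈ 𝓝 x, Bornology.IsBounded (⋃ z ∈ U ∩ C, F z)

section Switching

variable {E : Type*} [NormedAddCommGroup E] [NormedSpace ℝ E]

/-- The regularity of one flow map on `C` and global asymptotic stability of the point `zstar`. -/
structure RegularWithGASPoint (C : Set E) (F : E → Set E) (zstar : E) : Prop where
  outerSemicontinuous : OuterSemicontinuousRel F C
  locallyBounded : LocallyBoundedRel F C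
  nonempty : ∀ z ∈ C, (F z).Nonempty
  convex : ∀ z ∈ C, Convex ℝ (F z)
  globallyAsymptoticallyStable :
    (constrainedInclusion C F).IsGloballyAsymptoticallyStable {zstar}

/-- The only solution of the time-reversed inclusion `z ∈ C, ż ∈ -F(z)` with `z(0) = zstar` is
`z(t) = zstar`, `t ≥ 0`: this is a solution, and every solution from `zstar` agrees with it on its
domain. -/
def BackwardUnique (C : Set E) (F : E → Set E) (zstar : E) : Prop :=
  let H := constrainedInclusion C (fun z => {v | -v ∈ F z})
  (∃ x ∈ H.solutions {zstar}, x.dom = {p | 0 ≤ p.1 ∧ p.2 = 0} ∧ ∀ t ≥ 0, x.val t 0 = zstar) ∧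
    ∀ x ∈ H.solutions {zstar}, ∀ (t : ℝ) (j : ℕ), (t, j) ∈ x.dom → x.val t j = zstar

/-- The set `Σ = {1, …, M}` of modes, as a set of real numbers. -/
def modeSet (M : ℕ) : Set ℝ := {s | ∃ σ : ℕ, 1 ≤ σ ∧ σ ≤ M ∧ s = σ}

/-- The ideal hybrid system `Ĥ₀` with state `(z, σ, τ)`. Only `F σ` for `σ ∈ {1, …, M}` matters. -/
def idealSystem (C : Set E) (F : ℕ → E → Set E) (M N₀ : ℕ) : HybridSystem (E × ℝ × ℝ) where
  C := C ×ˢ modeSet M ×ˢ Icc (0 : ℝ) N₀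
  F := fun x => {v | (∃ σ : ℕ, 1 ≤ σ ∧ σ ≤ M ∧ x.2.1 = σ ∧ v.1 ∈ F σ x.1) ∧
    v.2.1 = 0 ∧ v.2.2 = 0}
  D := C ×ˢ modeSet M ×ˢ Icc (1 : ℝ) N₀
  G := fun x => {y | y.1 = x.1 ∧ y.2.1 ∈ modeSet M \ {x.2.1} ∧ y.2.2 = x.2.2 - 1}

/-- `S_σ = ⋂_j closure (R₀(({z*_σ} + 𝔹/(j+1)) × {σ} × [0, N₀]))`. -/
def limitSetOfMode (C : Set E) (F : ℕ → E → Set E) (M N₀ : ℕ) (zstar : ℕ → E) (σ : ℕ) :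
    Set (E × ℝ × ℝ) :=
  ⋂ j : ℕ, closure ((idealSystem C F M N₀).reachable
    (Metric.closedBall (zstar σ) (1 / ((j : ℝ) + 1)) ×ˢ {(σ : ℝ)} ×ˢ Icc (0 : ℝ) N₀))

/-- `S = ⋃_{σ ∈ Σ} S_σ`. -/
def limitSet (C : Set E) (F : ℕ → E → Set E) (M N₀ : ℕ) (zstar : ℕ → E) : Set (E × ℝ × ℝ) :=
  ⋃ σ ∈ Icc 1 M, limitSetOfMode C F M N₀ zstar σ

/-- `K₀ = (⋃_{σ ∈ Σ} {z*_σ} × {σ}) × [0, N₀]`. -/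
def equilibriaSet (M N₀ : ℕ) (zstar : ℕ → E) : Set (E × ℝ × ℝ) :=
  ⋃ σ ∈ Icc 1 M, {zstar σ} ×ˢ {(σ : ℝ)} ×ˢ Icc (0 : ℝ) N₀

end Switching

/-! Each jump costs one unit of a timer that starts at most at `N₀` and stays nonnegative, so a
solution has at most `N₀` jumps. It is therefore a chain of boundedly many flow segments joined by
jumps (`ChainReach`), and `t + j → ∞` forces `t → ∞`.

For `Ω₀(K) ⊆ S`, take chains from `K` with durations tending to infinity. Some segment becomes
arbitrarily long while the time before it stays bounded, so that segment starts in a bounded set. By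
attractivity, made uniform by compactness, it passes arbitrarily close to the equilibrium of its
mode. What follows is a chain starting near that equilibrium, so the limit of the endpoints lies in
`S` (`ChainReach.exists_near`).

For `S ⊆ Ω₀(K)`, a point of `S` is a limit of endpoints of chains whose initial points tend to an
equilibrium, hence eventually lie in `K`. If the durations are unbounded, these chains serve
directly. Otherwise a limit chain starts at the equilibrium itself and ends at the given point
(`ChainReach.of_tendsto`). Since (b) gives `0 ∈ F σ (zstar σ)`, the chain may first wait there as
long as desired (`ChainReach.prepend_const`).

Both directions rest on compactness of flows: bounded flows are closed under limits
(`IsFlow.of_tendsto`), and flows of bounded duration from a bounded set are uniformly bounded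
(`RegularWithGASPoint.exists_forall_norm_le`). Limits are taken along an ultrafilter, which replaces
repeated passage to subsequences. -/

open scoped NNReal

/-! ### Absolutely continuous curves with bounded derivative -/

section AbsoluteContinuity

theorem LipschitzWith.comp_absolutelyContinuousOnInterval {X Y : Type*} [PseudoMetricSpace X]
    [PseudoMetricSpace Y] {K : ℝ≥0} {φ : X → Y} (hφ : LipschitzWith K φ) {f : ℝ → X} {a b : ℝ}
    (hf : AbsolutelyContinuousOnInterval f a b) :
    AbsolutelyContinuousOnInterval (fun s => φ (f s)) a b := by
  unfold AbsolutelyContinuousOnInterval at hf ⊢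
  refine squeeze_zero (fun _ => Finset.sum_nonneg fun _ _ => dist_nonneg) (fun I => ?_)
    (by simpa using hf.const_mul (K : ℝ))
  rw [Finset.mul_sum]
  exact Finset.sum_le_sum fun _ _ => hφ.dist_le_mul _ _

theorem AbsolutelyContinuousOnInterval.sub_le_mul_sub {g : ℝ → ℝ} {a b c : ℝ} (hab : a ≤ b)
    (hg : AbsolutelyContinuousOnInterval g a b)
    (h : ∀ᵐ s : ℝ, s ∈ Ioo a b → ∃ d ≤ c, HasDerivAt g d s) : g b - g a ≤ c * (b - a) := by
  rw [← hg.integral_deriv_eq_sub]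
  have h1 : ∫ s in a..b, deriv g s ≤ ∫ _ in a..b, c := by
    refine intervalIntegral.integral_mono_ae_restrict hab hg.intervalIntegrable_deriv
      intervalIntegrable_const ?_
    rw [← Measure.restrict_congr_set Ioo_ae_eq_Icc]
    refine (ae_restrict_iff' measurableSet_Ioo).2 ?_
    filter_upwards [h] with s hs hsab
    obtain ⟨d, hd, hgd⟩ := hs hsab
    rwa [hgd.deriv]
  refine h1.trans_eq ?_
  simp [mul_comm]

theorem AbsolutelyContinuousOnInterval.lipschitzOnWith {E : Type*} [NormedAddCommGroup E]
    [NormedSpace ℝ E] {f : ℝ → E} {a b : ℝ} {L : ℝ≥0} (hab : a ≤ b)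
    (hf : AbsolutelyContinuousOnInterval f a b)
    (h : ∀ᵐ s : ℝ, s ∈ Ioo a b → ∃ v, ‖v‖ ≤ L ∧ HasDerivAt f v s) :
    LipschitzOnWith L f (Icc a b) := by
  have key : ∀ s ∈ Icc a b, ∀ r ∈ Icc a b, s ≤ r → ‖f r - f s‖ ≤ L * (r - s) := by
    intro s hs r hr hsr
    -- A norming functional of the increment reduces the estimate to a scalar function.
    obtain ⟨g, hg1, hg2⟩ := exists_dual_vector'' ℝ (f r - f s)
    have hac : AbsolutelyContinuousOnInterval (fun t => g (f t)) s r := by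
      refine g.lipschitz.comp_absolutelyContinuousOnInterval (hf.mono ?_)
      rw [uIcc_of_le hsr, uIcc_of_le hab]
      exact Icc_subset_Icc hs.1 hr.2
    have := hac.sub_le_mul_sub (c := L) hsr (by
      filter_upwards [h] with t ht hst
      obtain ⟨v, hv, hfv⟩ := ht ⟨hs.1.trans_lt hst.1, hst.2.trans_le hr.2⟩
      refine ⟨g v, ?_, g.hasFDerivAt.comp_hasDerivAt t hfv⟩
      calc g v ≤ ‖g v‖ := le_abs_self _
        _ ≤ ‖g‖ * ‖v‖ := g.le_opNorm v
        _ ≤ 1 * L := by gcongr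
        _ = L := one_mul _)
    rw [← map_sub, hg2] at this
    simpa using this
  refine LipschitzOnWith.of_dist_le_mul fun s hs r hr => ?_
  rcases le_total s r with hsr | hsr
  · rw [dist_comm, dist_eq_norm, dist_comm, Real.dist_eq, abs_of_nonneg (sub_nonneg.2 hsr)]
    exact key s hs r hr hsr
  · rw [dist_eq_norm, Real.dist_eq, abs_of_nonneg (sub_nonneg.2 hsr)]
    exact key r hr s hs hsr

end AbsoluteContinuity

/-! ### Bounds and upper semicontinuity for set-valued maps -/

section SetValued

variable {E : Type*} [NormedAddCommGroup E] {C : Set E} {F : E → Set E}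

theorem LocallyBoundedRel.exists_norm_le (hF : LocallyBoundedRel F C) {S : Set E}
    (hS : IsCompact S) (hSC : S ⊆ C) : ∃ L : ℝ≥0, ∀ z ∈ S, ∀ w ∈ F z, ‖w‖ ≤ L := by
  refine hS.induction_on (p := fun S => ∃ L : ℝ≥0, ∀ z ∈ S, ∀ w ∈ F z, ‖w‖ ≤ L) ⟨0, by simp⟩
    ?_ ?_ ?_
  · rintro s t hst ⟨L, hL⟩
    exact ⟨L, fun z hz => hL z (hst hz)⟩
  · rintro s t ⟨L, hL⟩ ⟨L', hL'⟩
    refine ⟨max L L', ?_⟩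
    rintro z (hz | hz) w hw
    · exact (hL z hz w hw).trans (by simp)
    · exact (hL' z hz w hw).trans (by simp)
  · intro x hx
    obtain ⟨U, hU, hb⟩ := hF x (hSC hx)
    obtain ⟨R, hR⟩ := hb.exists_norm_le
    refine ⟨U ∩ S, inter_mem (mem_nhdsWithin_of_mem_nhds hU) self_mem_nhdsWithin, R.toNNReal, ?_⟩
    intro z hz w hw
    exact (hR w (mem_biUnion (⟨hz.1, hSC hz.2⟩ : z ∈ U ∩ C) hw)).trans (Real.le_coe_toNNReal R)

theorem OuterSemicontinuousRel.isClosed (hF : OuterSemicontinuousRel F C) {x : E} (hx : x ∈ C) :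
    IsClosed (F x) :=
  isClosed_of_closure_subset fun y hy => by
    obtain ⟨w, hw, hwy⟩ := mem_closure_iff_seq_limit.1 hy
    exact hF (fun _ => x) w x y hx (fun i => ⟨hx, hw i⟩) tendsto_const_nhds hwy

variable [NormedSpace ℝ E] [FiniteDimensional ℝ E]

theorem LocallyBoundedRel.exists_norm_le_of_norm_le (hF : LocallyBoundedRel F C)
    (hC : IsClosed C) (R : ℝ) : ∃ L : ℝ≥0, ∀ z ∈ C, ‖z‖ ≤ R → ∀ w ∈ F z, ‖w‖ ≤ L := by
  have := FiniteDimensional.proper_real E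
  obtain ⟨L, hL⟩ := hF.exists_norm_le ((isCompact_closedBall (0 : E) R).inter_right hC)
    inter_subset_right
  exact ⟨L, fun z hz hzR => hL z ⟨by simpa using hzR, hz⟩⟩

/-- Values violating the bound at points tending to `x` would be bounded, hence have a cluster
point; outer semicontinuity puts it in `F x`, where `l` is below `c`. This is the form in which
upper semicontinuity is combined with a separating hyperplane. -/
theorem OuterSemicontinuousRel.eventually_le (hF : OuterSemicontinuousRel F C)
    (hb : LocallyBoundedRel F C) {x : E} (hx : x ∈ C) {l : StrongDual ℝ E} {c : ℝ}
    (h : ∀ w ∈ F x, l w < c) : ∀ᶠ z in 𝓝[C] x, ∀ w ∈ F z, l w ≤ c := by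
  have := FiniteDimensional.proper_real E
  by_contra hcon
  obtain ⟨U, hU, hUb⟩ := hb x hx
  have hfr : ∃ᶠ z in 𝓝[C] x, (∃ w ∈ F z, c < l w) ∧ z ∈ U ∩ C := by
    refine Frequently.and_eventually ?_
      (inter_mem (mem_nhdsWithin_of_mem_nhds hU) self_mem_nhdsWithin)
    rw [not_eventually] at hcon
    exact hcon.mono fun z hz => by push Not at hz; exact hz
  obtain ⟨z, hz, hzP⟩ := exists_seq_forall_of_frequently hfr
  choose w hw hcw using fun n => (hzP n).1
  obtain ⟨y, -, φ, hφ, hy⟩ := tendsto_subseq_of_bounded hUb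
    (fun n => mem_biUnion (hzP n).2 (hw n))
  have hy' := hF (z ∘ φ) (w ∘ φ) x y hx (fun i => ⟨(hzP _).2.2, hw _⟩)
    ((tendsto_nhds_of_tendsto_nhdsWithin hz).comp hφ.tendsto_atTop) hy
  have : c ≤ l y := ge_of_tendsto ((l.continuous.tendsto y).comp hy)
    (Eventually.of_forall fun n => (hcw _).le)
  exact absurd (h y hy') (not_lt.2 this)

end SetValued

/-! ### Flows of a differential inclusion and their limits -/

section Flow

variable {E : Type*} [NormedAddCommGroup E] [NormedSpace ℝ E] {C : Set E} {F : E → Set E}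

/-- `u` is a Lipschitz solution of `u ∈ C`, `u' ∈ F u` on `[0, T]`. -/
structure IsFlow (C : Set E) (F : E → Set E) (u : ℝ → E) (T : ℝ) : Prop where
  nonneg : 0 ≤ T
  lipschitz : ∃ L : ℝ≥0, LipschitzOnWith L u (Icc 0 T)
  mem : ∀ s ∈ Icc 0 T, u s ∈ C
  deriv : ∀ᵐ s : ℝ, s ∈ Ioo 0 T → ∃ v ∈ F (u s), HasDerivAt u v s

namespace IsFlow

variable {u : ℝ → E} {T : ℝ}

theorem mono (hu : IsFlow C F u T) {t : ℝ} (ht : t ∈ Icc 0 T) : IsFlow C F u t where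
  nonneg := ht.1
  lipschitz := hu.lipschitz.imp fun _ h => h.mono (Icc_subset_Icc_right ht.2)
  mem s hs := hu.mem s ⟨hs.1, hs.2.trans ht.2⟩
  deriv := by
    filter_upwards [hu.deriv] with s h hs
    exact h ⟨hs.1, hs.2.trans_le ht.2⟩

theorem absolutelyContinuousOnInterval (hu : IsFlow C F u T) {a b : ℝ} (hab : a ≤ b)
    (h : Icc a b ⊆ Icc 0 T) : AbsolutelyContinuousOnInterval u a b := by
  obtain ⟨L, hL⟩ := hu.lipschitz
  refine LipschitzOnWith.absolutelyContinuousOnInterval (hL.mono ?_)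
  rwa [uIcc_of_le hab]

theorem lipschitzOnWith (hu : IsFlow C F u T) {R : ℝ} {L : ℝ≥0}
    (hL : ∀ z ∈ C, ‖z‖ ≤ R → ∀ w ∈ F z, ‖w‖ ≤ L) {a b : ℝ} (hab : a ≤ b)
    (h : Icc a b ⊆ Icc 0 T) (hR : ∀ s ∈ Ioo a b, ‖u s‖ ≤ R) : LipschitzOnWith L u (Icc a b) := by
  refine (hu.absolutelyContinuousOnInterval hab h).lipschitzOnWith hab ?_
  filter_upwards [hu.deriv] with s hs hsab
  have h0 := h ⟨le_rfl, hab⟩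
  have h1 := h ⟨hab, le_rfl⟩
  obtain ⟨v, hv, hd⟩ := hs ⟨h0.1.trans_lt hsab.1, hsab.2.trans_le h1.2⟩
  exact ⟨v, hL _ (hu.mem s (h (Ioo_subset_Icc_self hsab))) (hR s hsab) v hv, hd⟩

theorem shift (hu : IsFlow C F u T) {a : ℝ} (ha : a ∈ Icc 0 T) :
    IsFlow C F (fun s => u (a + s)) (T - a) where
  nonneg := sub_nonneg.2 ha.2
  lipschitz := by
    obtain ⟨L, hL⟩ := hu.lipschitz
    refine ⟨L, LipschitzOnWith.of_dist_le_mul fun s hs r hr => ?_⟩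
    have := hL.dist_le_mul (a + s) ⟨by linarith [ha.1, hs.1], by linarith [hs.2]⟩
      (a + r) ⟨by linarith [ha.1, hr.1], by linarith [hr.2]⟩
    simpa using this
  mem s hs := hu.mem _ ⟨by linarith [ha.1, hs.1], by linarith [hs.2]⟩
  deriv := by
    have := (measurePreserving_add_left volume a).quasiMeasurePreserving.ae hu.deriv
    filter_upwards [this] with s h hs
    obtain ⟨v, hv, hd⟩ := h ⟨by linarith [ha.1, hs.1], by linarith [hs.2]⟩
    exact ⟨v, hv, hd.comp_const_add a s⟩

/-- Resting at the initial point is admissible because zero is a velocity there; the possible corner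
at `a` is a null set. -/
theorem prepend_const (hu : IsFlow C F u T) (h0 : (0 : E) ∈ F (u 0)) {a : ℝ} (ha : 0 ≤ a) :
    IsFlow C F (fun s => u (max 0 (s - a))) (a + T) where
  nonneg := add_nonneg ha hu.nonneg
  lipschitz := by
    obtain ⟨L, hL⟩ := hu.lipschitz
    refine ⟨L, LipschitzOnWith.of_dist_le_mul fun s hs r hr => ?_⟩
    have := hu.nonneg
    refine (hL.dist_le_mul (max 0 (s - a)) ⟨le_max_left _ _, max_le this (by linarith [hs.2])⟩
      (max 0 (r - a)) ⟨le_max_left _ _, max_le this (by linarith [hr.2])⟩).trans ?_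
    gcongr
    rw [Real.dist_eq, Real.dist_eq, max_comm 0, max_comm 0]
    refine (abs_max_sub_max_le_abs _ _ _).trans ?_
    simp
  mem s hs := hu.mem _ ⟨le_max_left _ _, max_le hu.nonneg (by linarith [hs.2])⟩
  deriv := by
    have h1 := (measurePreserving_sub_right volume a).quasiMeasurePreserving.ae hu.deriv
    have h2 : ∀ᵐ s : ℝ, s ≠ a := Measure.ae_ne volume a
    filter_upwards [h1, h2] with s h hsa hs
    rcases lt_or_gt_of_ne hsa with hlt | hgt
    · have he : (fun s => u (max 0 (s - a))) =ᶠ[𝓝 s] fun _ => u 0 := by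
        filter_upwards [Iio_mem_nhds hlt] with r hr
        rw [max_eq_left (by linarith [mem_Iio.1 hr])]
      refine ⟨0, ?_, (hasDerivAt_const s (u 0)).congr_of_eventuallyEq he⟩
      rw [max_eq_left (by linarith)]
      exact h0
    · have he : (fun s => u (max 0 (s - a))) =ᶠ[𝓝 s] fun s => u (s - a) := by
        filter_upwards [Ioi_mem_nhds hgt] with r hr
        rw [max_eq_right (by linarith [mem_Ioi.1 hr])]
      obtain ⟨v, hv, hd⟩ := h ⟨by linarith, by linarith [hs.2]⟩
      refine ⟨v, ?_, (hd.comp_sub_const s a).congr_of_eventuallyEq he⟩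
      rwa [max_eq_right (by linarith)]

/-- A flow that starts at `a` in a ball of radius `R`, and whose speed in the ball of radius
`R + 1` is at most `L`, needs some time to leave the latter ball. -/
theorem norm_le_add_one (hu : IsFlow C F u T) {R : ℝ} {L : ℝ≥0}
    (hL : ∀ z ∈ C, ‖z‖ ≤ R + 1 → ∀ w ∈ F z, ‖w‖ ≤ L) {a s : ℝ} (ha : 0 ≤ a) (has : a ≤ s)
    (hs : s ≤ T) (haR : ‖u a‖ ≤ R) (hδ : L * (s - a) < 1) : ‖u s‖ ≤ R + 1 := by
  by_contra! hcon
  have hsub : Icc a s ⊆ Icc 0 T := Icc_subset_Icc ha hs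
  have hcont : ContinuousOn u (Icc a s) := by
    obtain ⟨K, hK⟩ := hu.lipschitz
    exact hK.continuousOn.mono hsub
  have hA : IsCompact (Icc a s ∩ (fun r => ‖u r‖) ⁻¹' Ici (R + 1)) :=
    isCompact_Icc.of_isClosed_subset
      (hcont.norm.preimage_isClosed_of_isClosed isClosed_Icc isClosed_Ici) inter_subset_left
  -- At the first time `m` when the norm reaches `R + 1`, the speed bound has held throughout, so
  -- the distance travelled is less than `1`.
  obtain ⟨m, ⟨hm, hmR⟩, hmin⟩ := hA.exists_isLeast ⟨s, ⟨has, le_rfl⟩, hcon.le⟩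
  have hlip := hu.lipschitzOnWith hL hm.1 ((Icc_subset_Icc_right hm.2).trans hsub) (by
    intro r hr
    by_contra! hrR
    exact absurd (hmin ⟨⟨hr.1.le, hr.2.le.trans hm.2⟩, hrR.le⟩) (not_le.2 hr.2))
  have h1 := hlip.dist_le_mul m ⟨hm.1, le_rfl⟩ a ⟨le_rfl, hm.1⟩
  rw [Real.dist_eq, abs_of_nonneg (sub_nonneg.2 hm.1), dist_eq_norm] at h1
  have h2 : (L : ℝ) * (m - a) ≤ L * (s - a) := by gcongr; exact hm.2
  have h3 := norm_le_norm_add_norm_sub' (u m) (u a)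
  have h4 : R + 1 ≤ ‖u m‖ := hmR
  linarith

/-- Bounded flows are closed under pointwise limits. -/
theorem of_tendsto [FiniteDimensional ℝ E] {ι : Type*} {l : Filter ι} [l.NeBot] (hC : IsClosed C)
    (hosc : OuterSemicontinuousRel F C) (hbdd : LocallyBoundedRel F C)
    (hconv : ∀ z ∈ C, Convex ℝ (F z)) {u : ι → ℝ → E} {T : ι → ℝ} {v : ℝ → E} {T₀ R : ℝ}
    (hu : ∀ᶠ i in l, IsFlow C F (u i) (T i)) (hT : Tendsto T l (𝓝 T₀))
    (hR : ∀ᶠ i in l, ∀ s ∈ Icc 0 (T i), ‖u i s‖ ≤ R)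
    (hv : ∀ s ∈ Icc 0 T₀, Tendsto (fun i => u i (min s (T i))) l (𝓝 (v s))) :
    IsFlow C F v T₀ := by
  obtain ⟨L, hL⟩ := hbdd.exists_norm_le_of_norm_le hC R
  have hlip : ∀ᶠ i in l, LipschitzOnWith L (u i) (Icc 0 (T i)) := by
    filter_upwards [hu, hR] with i hi hiR
    exact hi.lipschitzOnWith hL hi.nonneg le_rfl fun s hs => hiR s (Ioo_subset_Icc_self hs)
  have hvlip : LipschitzOnWith L v (Icc 0 T₀) := by
    refine LipschitzOnWith.of_dist_le_mul fun s hs r hr => ?_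
    refine le_of_tendsto ((hv s hs).dist (hv r hr)) ?_
    filter_upwards [hu, hlip] with i hi hil
    refine (hil.dist_le_mul _ ⟨le_min hs.1 hi.nonneg, min_le_right _ _⟩ _
      ⟨le_min hr.1 hi.nonneg, min_le_right _ _⟩).trans ?_
    gcongr
    rw [Real.dist_eq, Real.dist_eq]
    simpa using abs_min_sub_min_le_max s (T i) r (T i)
  have hvC : ∀ s ∈ Icc 0 T₀, v s ∈ C := fun s hs => hC.mem_of_tendsto (hv s hs) <| by
    filter_upwards [hu] with i hi
    exact hi.mem _ ⟨le_min hs.1 hi.nonneg, min_le_right _ _⟩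
  have hT₀ : 0 ≤ T₀ := ge_of_tendsto hT (hu.mono fun i hi => hi.nonneg)
  refine ⟨hT₀, ⟨L, hvlip⟩, hvC, ?_⟩
  have hdiff := (ae_restrict_iff' measurableSet_Icc).1
    (hvlip.ae_differentiableWithinAt_real measurableSet_Icc)
  filter_upwards [hdiff] with s hs hsI
  have hs' := hs (Ioo_subset_Icc_self hsI)
  have hd := (hs'.differentiableAt (Icc_mem_nhds hsI.1 hsI.2)).hasDerivAt
  refine ⟨_, ?_, hd⟩
  have hsC := hvC s (Ioo_subset_Icc_self hsI)
  by_contra hmem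
  -- A derivative outside the closed convex set `F (v s)` is strictly separated from it by `f`. The
  -- difference quotients of `f ∘ v` will contradict this.
  obtain ⟨f, c, hfc, hcf⟩ := geometric_hahn_banach_closed_point (hconv _ hsC)
    (hosc.isClosed hsC) hmem
  obtain ⟨δ, hδ, hδf⟩ := Metric.eventually_nhds_iff.1
    (eventually_nhdsWithin_iff.1 (hosc.eventually_le hbdd hsC hfc))
  -- Half of `δ` absorbs the error `u i s - v s`, the other half the motion of `u i` after `s`. So
  -- `u i` stays where `f ≤ c` on the velocities, and the resulting bound on increments survives the
  -- limit.
  have hquot : ∀ᶠ h in 𝓝[>] s, slope (fun r => f (v r)) s h ≤ c := by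
    have hsmall : ∀ᶠ h in 𝓝[>] s, L * (h - s) < δ / 2 := by
      refine mem_nhdsWithin_of_mem_nhds ?_
      have : Tendsto (fun h : ℝ => (L : ℝ) * (h - s)) (𝓝 s) (𝓝 ((L : ℝ) * (s - s))) :=
        (by fun_prop : Continuous fun h : ℝ => (L : ℝ) * (h - s)).tendsto s
      refine this.eventually (gt_mem_nhds ?_)
      simpa using hδ
    filter_upwards [hsmall, Ioo_mem_nhdsGT hsI.2] with h hh hhs
    rw [slope_def_field, div_le_iff₀ (sub_pos.2 hhs.1)]
    have hh0 : h ∈ Icc 0 T₀ := ⟨hsI.1.le.trans hhs.1.le, hhs.2.le⟩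
    refine le_of_tendsto (((f.continuous.tendsto _).comp (hv h hh0)).sub
      ((f.continuous.tendsto _).comp (hv s (Ioo_subset_Icc_self hsI)))) ?_
    filter_upwards [hu, hlip, hT.eventually (lt_mem_nhds hhs.2),
      (hv s (Ioo_subset_Icc_self hsI)).eventually (Metric.ball_mem_nhds _ (half_pos hδ))]
      with i hi hil hiT hid
    have hsT : s < T i := hhs.1.trans hiT
    simp only [Function.comp_apply, min_eq_left hiT.le, min_eq_left hsT.le] at hid ⊢
    refine (f.lipschitz.comp_absolutelyContinuousOnInterval
      (hi.absolutelyContinuousOnInterval hhs.1.le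
        (Icc_subset_Icc hsI.1.le hiT.le))).sub_le_mul_sub hhs.1.le ?_
    filter_upwards [hi.deriv] with r hr hrI
    have hrT : r ∈ Ioo 0 (T i) := ⟨hsI.1.trans hrI.1, hrI.2.trans hiT⟩
    obtain ⟨w, hw, hdw⟩ := hr hrT
    refine ⟨f w, hδf ?_ (hi.mem r (Ioo_subset_Icc_self hrT)) w hw,
      f.hasFDerivAt.comp_hasDerivAt r hdw⟩
    have h1 := hil.dist_le_mul r (Ioo_subset_Icc_self hrT) s ⟨hsI.1.le, hsT.le⟩
    rw [Real.dist_eq, abs_of_nonneg (sub_nonneg.2 hrI.1.le)] at h1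
    have h2 : (L : ℝ) * (r - s) ≤ L * (h - s) := by gcongr; exact hrI.2.le
    have h3 := dist_triangle (u i r) (u i s) (v s)
    linarith
  have hfd : HasDerivAt (fun r => f (v r)) (f (_root_.deriv v s)) s :=
    f.hasFDerivAt.comp_hasDerivAt s hd
  have hlim := (hasDerivWithinAt_iff_tendsto_slope' (by simp)).1
    (hfd.hasDerivWithinAt (s := Ioi s))
  exact absurd (le_of_tendsto hlim hquot) (not_le.2 hcf)

end IsFlow

end Flow

/-! ### Limits along ultrafilters -/

section UltrafilterLimits

variable {ι : Type*} {U : Ultrafilter ι}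

theorem Ultrafilter.exists_tendsto_of_norm_le {E : Type*} [NormedAddCommGroup E] [ProperSpace E]
    {f : ι → E} {R : ℝ} (h : ∀ᶠ i in U, ‖f i‖ ≤ R) : ∃ a, Tendsto f U (𝓝 a) := by
  obtain ⟨a, -, ha⟩ := (isCompact_closedBall (0 : E) R).ultrafilter_le_nhds (U.map f)
    (by
      rw [Ultrafilter.coe_map, le_principal_iff, Filter.mem_map]
      filter_upwards [h] with i hi
      simpa using hi)
  exact ⟨a, ha⟩

theorem Filter.Tendsto.eventually_norm_le {E : Type*} [NormedAddCommGroup E] {l : Filter ι}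
    {f : ι → E} {a : E} (h : Tendsto f l (𝓝 a)) : ∀ᶠ i in l, ‖f i‖ ≤ ‖a‖ + 1 :=
  h.norm.eventually_le_const (lt_add_one _)

theorem Ultrafilter.tendsto_atTop_or_eventually_le (f : ι → ℝ) :
    Tendsto f U atTop ∨ ∃ B, ∀ᶠ i in U, f i ≤ B := by
  by_cases h : ∃ B, ∀ᶠ i in U, f i ≤ B
  · exact .inr h
  · push Not at h
    refine .inl (tendsto_atTop.2 fun B => ?_)
    exact (h B).mono fun i hi => hi.le

end UltrafilterLimits

/-! ### Uniform boundedness and attraction of flows -/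

section ArcOfFlow

variable {E : Type*} [NormedAddCommGroup E] [NormedSpace ℝ E] {C : Set E} {F : E → Set E}

/-- A flow on an interval `I ∋ 0` is the solution of the constrained differential inclusion. -/
theorem exists_solution_of_isFlow {I : Set ℝ} {u : ℝ → E} (h0 : (0 : ℝ) ∈ I)
    (hI : ∀ t ∈ I, Icc 0 t ⊆ I) (hu : ∀ t ∈ I, IsFlow C F u t) :
    ∃ x ∈ (constrainedInclusion C F).solutions {u 0},
      (∀ t j, (t, j) ∈ x.dom ↔ t ∈ I ∧ j = 0) ∧ ∀ t j, x.val t j = u t := by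
  refine ⟨⟨{p | p.1 ∈ I ∧ p.2 = 0}, fun t _ => u t, ⟨⟨(0, 0), h0, rfl⟩, ?_⟩, ?_⟩, ⟨⟨?_, ?_, ?_, ?_⟩,
    rfl⟩, fun _ _ => Iff.rfl, fun _ _ => rfl⟩
  · rintro ⟨p, j⟩ ⟨hp, rfl : j = 0⟩
    have hp' : p ∈ I := hp
    refine ⟨0, fun k => if k = 0 then 0 else p, by simp, ?_, ?_⟩
    · intro a b hab
      have := (hu p hp).nonneg
      dsimp only
      split_ifs <;> first | omega | linarith
    · ext ⟨s, k⟩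
      simp only [mem_inter_iff, mem_ofPred_eq]
      constructor
      · rintro ⟨⟨-, rfl⟩, h0s, hsp, -⟩
        simpa using ⟨h0s, hsp⟩
      · rintro ⟨hk, hs1, hs2⟩
        obtain rfl : k = 0 := by omega
        simp only [if_true, zero_add, one_ne_zero, if_false] at hs1 hs2
        exact ⟨⟨hI p hp ⟨hs1, hs2⟩, rfl⟩, hs1, hs2, le_rfl⟩
  · intro j a b hab h
    have ha := h a ⟨le_rfl, hab⟩
    have hb := h b ⟨hab, le_rfl⟩
    exact (hu b hb.1).absolutelyContinuousOnInterval hab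
      (Icc_subset_Icc_left (hu a ha.1).nonneg)
  · exact .inl (subset_closure ((hu 0 h0).mem 0 (by simp)))
  · intro j t ht
    have ht' := (interior_subset ht).1
    exact (hu t ht').mem t ⟨(hu t ht').nonneg, le_rfl⟩
  · intro j
    -- Each `t ∈ I` has its own exceptional null set; rational endpoints leave only countably many.
    have hae : ∀ᵐ s : ℝ, ∀ q : ℚ, (q : ℝ) ∈ I → s ∈ Ioo (0 : ℝ) q →
        ∃ v ∈ F (u s), HasDerivAt u v s := by
      refine ae_all_iff.2 fun q => ?_
      by_cases hq : (q : ℝ) ∈ I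
      · filter_upwards [(hu q hq).deriv] with s hs _ using hs
      · exact Eventually.of_forall fun s hs => absurd hs hq
    filter_upwards [hae] with s hs hsI
    have hsn := mem_interior_iff_mem_nhds.1 hsI
    obtain ⟨a, b, hsab, hab⟩ := mem_nhds_iff_exists_Ioo_subset.1 hsn
    obtain ⟨q, hsq, hqb⟩ := exists_rat_btwn hsab.2
    obtain ⟨r, har, hrs⟩ := exists_rat_btwn hsab.1
    have hq := (hab ⟨hsab.1.trans hsq, hqb⟩).1
    have hr := (hu r (hab ⟨har, hrs.trans hsab.2⟩).1).nonneg
    exact hs q hq ⟨hr.trans_lt hrs, hsq⟩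
  · rintro t j - ⟨-, h⟩
    simp at h

namespace RegularWithGASPoint

variable {z : E}

/-- The interval may be half-open: boundedness is assumed for solutions that are not complete, which
rules out blow-up at its right end. -/
theorem exists_norm_le (hF : RegularWithGASPoint C F z) {I : Set ℝ} {u : ℝ → E}
    (h0 : (0 : ℝ) ∈ I) (hI : ∀ t ∈ I, Icc 0 t ⊆ I) (hu : ∀ t ∈ I, IsFlow C F u t) :
    ∃ R, ∀ t ∈ I, ‖u t‖ ≤ R := by
  obtain ⟨x, hx, hdom, hval⟩ := exists_solution_of_isFlow h0 hI hu
  have hb : u 0 ∈ (constrainedInclusion C F).basinOfAttraction {z} := by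
    rw [hF.globallyAsymptoticallyStable.2.2]; trivial
  obtain ⟨R, hR⟩ := (hb x hx).1.exists_norm_le
  exact ⟨R, fun t ht => hR _ ⟨t, 0, (hdom t 0).2 ⟨ht, rfl⟩, (hval t 0).symm⟩⟩

theorem exists_norm_sub_lt (hF : RegularWithGASPoint C F z) {u : ℝ → E}
    (hu : ∀ t, 0 ≤ t → IsFlow C F u t) {ε : ℝ} (hε : 0 < ε) : ∃ t, 0 ≤ t ∧ ‖u t - z‖ < ε := by
  obtain ⟨x, hx, hdom, hval⟩ := exists_solution_of_isFlow (I := Ici 0) (mem_Ici.2 le_rfl)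
    (fun t _ => Icc_subset_Ici_self) hu
  have hb : u 0 ∈ (constrainedInclusion C F).basinOfAttraction {z} := by
    rw [hF.globallyAsymptoticallyStable.2.2]; trivial
  obtain ⟨T, hT⟩ := (hb x hx).2 (fun R => ⟨max 0 R, 0, (hdom _ _).2 ⟨le_max_left (0 : ℝ) R, rfl⟩, by simp⟩)
    ε hε
  have h := hT (max 0 T) 0 ((hdom _ _).2 ⟨le_max_left (0 : ℝ) T, rfl⟩) (by simp)
  rw [Metric.infDist_singleton, hval, dist_eq_norm] at h
  exact ⟨_, le_max_left _ _, h⟩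

variable [FiniteDimensional ℝ E] {ι : Type*} {U : Ultrafilter ι} {u : ι → ℝ → E} {T : ι → ℝ}

theorem isFlow_of_tendsto (hF : RegularWithGASPoint C F z) (hC : IsClosed C)
    (hu : ∀ᶠ i in U, IsFlow C F (u i) (T i)) {v : ℝ → E} {t R : ℝ} (ht : 0 ≤ t)
    (htT : ∀ᶠ i in U, t ≤ T i) (hR : ∀ᶠ i in U, ∀ s ∈ Icc 0 (T i), s ≤ t → ‖u i s‖ ≤ R)
    (hv : ∀ s ∈ Icc 0 t, Tendsto (fun i => u i s) U (𝓝 (v s))) : IsFlow C F v t := by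
  refine IsFlow.of_tendsto (T := fun _ => t) (R := R) hC hF.outerSemicontinuous hF.locallyBounded
    hF.convex ?_ tendsto_const_nhds ?_ (u := u) (l := U) ?_
  · filter_upwards [hu, htT] with i hi hit using hi.mono ⟨ht, hit⟩
  · filter_upwards [hR, htT] with i hi hit s hs using hi s ⟨hs.1, hs.2.trans hit⟩ hs.2
  · intro s hs
    simpa only [min_eq_left hs.2] using hv s hs

/-- Flows of bounded duration from a bounded set are uniformly bounded. -/
theorem exists_forall_norm_le (hF : RegularWithGASPoint C F z) (hC : IsClosed C)
    (hu : ∀ᶠ i in U, IsFlow C F (u i) (T i)) {B R₀ : ℝ} (hT : ∀ᶠ i in U, T i ≤ B)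
    (h0 : ∀ᶠ i in U, ‖u i 0‖ ≤ R₀) : ∃ R, ∀ᶠ i in U, ∀ s ∈ Icc 0 (T i), ‖u i s‖ ≤ R := by
  have := FiniteDimensional.proper_real E
  by_contra hcon
  -- `P t` says that the family is bounded up to time `t`. If the claim fails, `P` fails from `B`
  -- on, and `P t` forces almost all flows to last beyond `t`.
  set P : ℝ → Prop := fun t => ∃ R, ∀ᶠ i in U, ∀ s ∈ Icc 0 (T i), s ≤ t → ‖u i s‖ ≤ R with hP
  have hPB : ∀ t, B ≤ t → ¬ P t := by
    rintro t ht ⟨R, hR⟩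
    refine hcon ⟨R, ?_⟩
    filter_upwards [hR, hT] with i hi hiT s hs using hi s hs (hs.2.trans (hiT.trans ht))
  have hPT : ∀ t, P t → ∀ᶠ i in U, t ≤ T i := by
    rintro t ⟨R, hR⟩
    by_contra hlt
    refine hcon ⟨R, ?_⟩
    filter_upwards [hR, Ultrafilter.eventually_not.2 hlt] with i hi hiT s hs
    exact hi s hs (hs.2.trans (not_le.1 hiT).le)
  have hPmono : ∀ s t, s ≤ t → P t → P s := by
    rintro s t hst ⟨R, hR⟩
    exact ⟨R, hR.mono fun i hi r hr hrs => hi r hr (hrs.trans hst)⟩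
  -- The gain `δ` depends only on the bound `R` at time `t`, not on `t` nor on the bound over
  -- earlier times.
  have hext : ∀ R, ∃ δ > 0, ∀ t, 0 ≤ t → P t → (∀ᶠ i in U, ‖u i t‖ ≤ R) → P (t + δ) := by
    intro R
    obtain ⟨L, hL⟩ := hF.locallyBounded.exists_norm_le_of_norm_le hC (R + 1)
    refine ⟨1 / (L + 1), by positivity, fun t ht hPt hR => ?_⟩
    have htT := hPT t hPt
    obtain ⟨R', hR'⟩ := hPt
    refine ⟨max R' (R + 1), ?_⟩
    filter_upwards [hu, hR, hR'] with i hi hiR hiR' s hs hst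
    rcases le_total s t with h | h
    · exact (hiR' s hs h).trans (le_max_left _ _)
    · refine (hi.norm_le_add_one hL ht h hs.2 hiR ?_).trans (le_max_right _ _)
      calc (L : ℝ) * (s - t) ≤ L * (1 / (L + 1)) := by gcongr; linarith
        _ < 1 := by rw [mul_one_div, div_lt_one (by positivity)]; exact lt_add_one _
  have hP0 : P 0 := by
    refine ⟨R₀, ?_⟩
    filter_upwards [h0] with i hi s hs hs0
    rwa [le_antisymm hs0 hs.1]
  set A : Set ℝ := {t | 0 ≤ t ∧ P t} with hA
  have h0A : (0 : ℝ) ∈ A := ⟨le_rfl, hP0⟩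
  have hAB : BddAbove A := ⟨B, fun t ht => le_of_not_ge fun h => hPB t h ht.2⟩
  have hAI : ∀ t ∈ A, Icc 0 t ⊆ A := fun t ht s hs => ⟨hs.1, hPmono s t hs.2 ht.2⟩
  have hlim : ∀ t, ∃ a, t ∈ A → Tendsto (fun i => u i t) U (𝓝 a) := by
    intro t
    by_cases ht : t ∈ A
    · obtain ⟨R, hR⟩ := ht.2
      obtain ⟨a, ha⟩ := Ultrafilter.exists_tendsto_of_norm_le (f := fun i => u i t) (U := U) (R := R)
        (by filter_upwards [hR, hPT t ht.2] with i hi hiT using hi t ⟨ht.1, hiT⟩ le_rfl)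
      exact ⟨a, fun _ => ha⟩
    · exact ⟨0, fun h => absurd h ht⟩
  choose v hv using hlim
  have hflow : ∀ t ∈ A, IsFlow C F v t := by
    intro t ht
    obtain ⟨R, hR⟩ := ht.2
    exact hF.isFlow_of_tendsto hC hu ht.1 (hPT t ht.2) hR fun s hs => hv s (hAI t ht hs)
  -- The limit curve on `A` is bounded by a single `R`, so at each `t ∈ A` almost all flows have
  -- norm at most `R + 1`. Extending by `δ` from a time within `δ` of `sSup A` overshoots the
  -- supremum.
  obtain ⟨R, hR⟩ := hF.exists_norm_le h0A hAI hflow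
  obtain ⟨δ, hδ, hδP⟩ := hext (R + 1)
  obtain ⟨t, ht, hlt⟩ := exists_lt_of_lt_csSup ⟨0, h0A⟩ (sub_lt_self (sSup A) hδ)
  have h1 := hδP t ht.1 ht.2 (by
    filter_upwards [(hv t ht).eventually_norm_le] with i hi
    linarith [hR t ht])
  have h2 := le_csSup hAB (⟨by linarith [ht.1], h1⟩ : t + δ ∈ A)
  linarith

/-- Flows from a bounded set approach the attractor uniformly. -/
theorem exists_eventually_norm_sub_lt (hF : RegularWithGASPoint C F z) (hC : IsClosed C)
    (hu : ∀ᶠ i in U, IsFlow C F (u i) (T i)) (hT : Tendsto T U atTop) {R₀ : ℝ}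
    (h0 : ∀ᶠ i in U, ‖u i 0‖ ≤ R₀) {ε : ℝ} (hε : 0 < ε) :
    ∃ t, 0 ≤ t ∧ ∀ᶠ i in U, t ≤ T i ∧ ‖u i t - z‖ < ε := by
  have := FiniteDimensional.proper_real E
  have hT' := tendsto_atTop.1 hT
  have hb : ∀ t, 0 ≤ t → ∃ R, ∀ᶠ i in U, ∀ s ∈ Icc 0 t, ‖u i s‖ ≤ R := fun t ht =>
    hF.exists_forall_norm_le hC (T := fun _ => t) (B := t)
      (by filter_upwards [hu, hT' t] with i hi hit using hi.mono ⟨ht, hit⟩)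
      (Eventually.of_forall fun _ => le_rfl) h0
  have hlim : ∀ t, ∃ a, 0 ≤ t → Tendsto (fun i => u i t) U (𝓝 a) := by
    intro t
    by_cases ht : 0 ≤ t
    · obtain ⟨R, hR⟩ := hb t ht
      obtain ⟨a, ha⟩ := Ultrafilter.exists_tendsto_of_norm_le (f := fun i => u i t) (U := U) (R := R)
        (hR.mono fun i hi => hi t ⟨ht, le_rfl⟩)
      exact ⟨a, fun _ => ha⟩
    · exact ⟨0, fun h => absurd h ht⟩
  choose v hv using hlim
  -- The limit curve is a complete solution, so it comes within `ε` of `z` at some time; at that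
  -- same time almost all flows are within `ε` too.
  obtain ⟨t, ht, hlt⟩ := hF.exists_norm_sub_lt (u := v) (fun t ht => by
    obtain ⟨R, hR⟩ := hb t ht
    exact hF.isFlow_of_tendsto hC hu ht (hT' t)
      (hR.mono fun i hi s hs hst => hi s ⟨hs.1, hst⟩) fun s hs => hv s hs.1) hε
  refine ⟨t, ht, (hT' t).and ?_⟩
  exact ((hv t ht).sub_const z).norm.eventually_lt_const hlt

theorem exists_isFlow_of_tendsto (hF : RegularWithGASPoint C F z) (hC : IsClosed C)
    (hu : ∀ᶠ i in U, IsFlow C F (u i) (T i)) {T₀ : ℝ} (hT : Tendsto T U (𝓝 T₀)) {a b : E}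
    (ha : Tendsto (fun i => u i 0) U (𝓝 a)) (hb : Tendsto (fun i => u i (T i)) U (𝓝 b)) :
    ∃ v, IsFlow C F v T₀ ∧ v 0 = a ∧ v T₀ = b := by
  have := FiniteDimensional.proper_real E
  obtain ⟨R, hR⟩ := hF.exists_forall_norm_le hC hu
    (hT.eventually_le_const (lt_add_one T₀)) ha.eventually_norm_le
  have hlim : ∀ s, ∃ c, 0 ≤ s → Tendsto (fun i => u i (min s (T i))) U (𝓝 c) := by
    intro s
    by_cases hs : 0 ≤ s
    · obtain ⟨c, hc⟩ := Ultrafilter.exists_tendsto_of_norm_le (f := fun i => u i (min s (T i)))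
        (U := U) (R := R)
        (by filter_upwards [hR, hu] with i hi hiu using hi _ ⟨le_min hs hiu.nonneg, min_le_right _ _⟩)
      exact ⟨c, fun _ => hc⟩
    · exact ⟨0, fun h => absurd h hs⟩
  choose v hv using hlim
  have hT₀ : 0 ≤ T₀ := ge_of_tendsto hT (hu.mono fun i hi => hi.nonneg)
  refine ⟨v, IsFlow.of_tendsto hC hF.outerSemicontinuous hF.locallyBounded hF.convex hu hT hR
    fun s hs => hv s hs.1, ?_, ?_⟩
  · refine tendsto_nhds_unique (hv 0 le_rfl) (ha.congr' ?_)
    filter_upwards [hu] with i hi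
    rw [min_eq_left hi.nonneg]
  -- The common Lipschitz constant makes the value at `min T₀ (T i)` and the endpoint value at `T i`
  -- asymptotically equal.
  · obtain ⟨L, hL⟩ := hF.locallyBounded.exists_norm_le_of_norm_le hC R
    refine tendsto_nhds_unique (hv T₀ hT₀) ?_
    refine (tendsto_iff_of_dist ?_).2 hb
    refine squeeze_zero' (g := fun i => (L : ℝ) * |T₀ - T i|)
      (Eventually.of_forall fun _ => dist_nonneg) ?_ ?_
    · filter_upwards [hu, hR] with i hi hiR
      have hlip := hi.lipschitzOnWith hL hi.nonneg le_rfl fun s hs => hiR s (Ioo_subset_Icc_self hs)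
      refine (hlip.dist_le_mul _ ⟨le_min hT₀ hi.nonneg, min_le_right _ _⟩ _
        ⟨hi.nonneg, le_rfl⟩).trans ?_
      gcongr
      rw [Real.dist_eq]
      simpa using abs_min_sub_min_le_max T₀ (T i) (T i) (T i)
    · simpa using ((tendsto_const_nhds (x := T₀)).sub hT).abs.const_mul (L : ℝ)

end RegularWithGASPoint

end ArcOfFlow

/-! ### Jumps of the ideal system -/

section Jumps

variable {E : Type*}

/-- `y` is reached from `x` by a jump of the ideal system. -/
def JumpStep (C : Set E) (F : ℕ → E → Set E) (M N₀ : ℕ) (x y : E × ℝ × ℝ) : Prop :=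
  x ∈ (idealSystem C F M N₀).D ∧ y ∈ (idealSystem C F M N₀).G x

variable {C : Set E} {F : ℕ → E → Set E} {M N₀ : ℕ} {x y : E × ℝ × ℝ}

theorem finite_modeSet (M : ℕ) : (modeSet M).Finite :=
  ((finite_Icc 1 M).image ((↑) : ℕ → ℝ)).subset <| by
    rintro s ⟨σ, h1, h2, rfl⟩
    exact ⟨σ, ⟨h1, h2⟩, rfl⟩

theorem idealSystem_D_subset : (idealSystem C F M N₀).D ⊆ (idealSystem C F M N₀).C :=
  prod_mono le_rfl (prod_mono le_rfl (Icc_subset_Icc_left zero_le_one))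

theorem JumpStep.mem_C (h : JumpStep C F M N₀ x y) : y ∈ (idealSystem C F M N₀).C := by
  obtain ⟨⟨h1, h2, h3⟩, h4, h5, h6⟩ := h
  refine ⟨?_, h5.1, ?_⟩
  · rw [h4]; exact h1
  · rw [h6]; exact ⟨by linarith [h3.1], by linarith [h3.2]⟩

variable [TopologicalSpace E]

theorem isClosed_idealSystem_C (hC : IsClosed C) : IsClosed (idealSystem C F M N₀).C :=
  hC.prod ((finite_modeSet M).isClosed.prod isClosed_Icc)

theorem isClosed_idealSystem_D (hC : IsClosed C) : IsClosed (idealSystem C F M N₀).D :=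
  hC.prod ((finite_modeSet M).isClosed.prod isClosed_Icc)

end Jumps

/-! ### Chains of flows and jumps -/

section Chains

variable {E : Type*} [NormedAddCommGroup E] [NormedSpace ℝ E]

/-- `y` is reached from `x` by flowing for time `t` with the ideal system. -/
def FlowStep (C : Set E) (F : ℕ → E → Set E) (M N₀ : ℕ) (x : E × ℝ × ℝ) (t : ℝ)
    (y : E × ℝ × ℝ) : Prop :=
  ∃ σ ∈ Icc 1 M, x.2.1 = (σ : ℝ) ∧ x.2.2 ∈ Icc (0 : ℝ) N₀ ∧ y.2 = x.2 ∧
    ∃ u, IsFlow C (F σ) u t ∧ u 0 = x.1 ∧ u t = y.1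

/-- `y` is reached from `x` in time `t` with `j` jumps of the ideal system. -/
def ChainReach (C : Set E) (F : ℕ → E → Set E) (M N₀ : ℕ) :
    ℕ → E × ℝ × ℝ → ℝ → E × ℝ × ℝ → Prop
  | 0, x, t, y => FlowStep C F M N₀ x t y
  | j + 1, x, t, y => ∃ s x' x'', ChainReach C F M N₀ j x s x' ∧ JumpStep C F M N₀ x' x'' ∧
      FlowStep C F M N₀ x'' (t - s) y

variable {C : Set E} {F : ℕ → E → Set E} {M N₀ : ℕ} {x y : E × ℝ × ℝ} {t : ℝ}

theorem FlowStep.nonneg (h : FlowStep C F M N₀ x t y) : 0 ≤ t := by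
  obtain ⟨σ, -, -, -, -, u, hu, -⟩ := h
  exact hu.nonneg

theorem ChainReach.nonneg {j : ℕ} (h : ChainReach C F M N₀ j x t y) : 0 ≤ t := by
  induction j generalizing t y with
  | zero => exact FlowStep.nonneg h
  | succ j ih =>
    obtain ⟨s, x', x'', h1, -, h2⟩ := h
    linarith [ih h1, h2.nonneg]

/-- The timer is constant along flows and drops by one at each jump. This accounting bounds the
number of jumps by `N₀`. -/
theorem ChainReach.snd_mem {j : ℕ} (h : ChainReach C F M N₀ j x t y) :
    0 ≤ y.2.2 ∧ y.2.2 + j = x.2.2 ∧ x.2.2 ≤ N₀ := by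
  induction j generalizing t y with
  | zero =>
    obtain ⟨σ, -, -, h1, h2, -⟩ := h
    rw [h2]
    exact ⟨h1.1, by simp, h1.2⟩
  | succ j ih =>
    obtain ⟨s, x', x'', h1, ⟨-, -, -, h2⟩, σ, -, -, h3, h4, -⟩ := h
    obtain ⟨h5, h6, h7⟩ := ih h1
    refine ⟨h4 ▸ h3.1, ?_, h7⟩
    rw [h4, h2]
    push_cast
    linarith

theorem ChainReach.jumps_le {j : ℕ} (h : ChainReach C F M N₀ j x t y) : j ≤ N₀ := by
  obtain ⟨h1, h2, h3⟩ := h.snd_mem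
  exact_mod_cast (by linarith : (j : ℝ) ≤ N₀)

end Chains

/-! ### From hybrid solutions to chains -/

section SolutionToChain

variable {E : Type*} [NormedAddCommGroup E] [NormedSpace ℝ E]
  {C : Set E} {F : ℕ → E → Set E} {M N₀ : ℕ}

/-- Mode and timer have zero derivative almost everywhere, so by absolute continuity they are
constant. The `z` component has compact image in `C`, on which `F σ` is bounded, so it is Lipschitz.
-/
theorem HybridSystem.IsSolution.flowStep (hC : IsClosed C)
    (hF : ∀ σ ∈ Icc 1 M, LocallyBoundedRel (F σ) C) {x : HybridArc (E × ℝ × ℝ)}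
    (hx : (idealSystem C F M N₀).IsSolution x) {a b : ℝ} {i : ℕ} (hab : a ≤ b)
    (hdom : ∀ s ∈ Icc a b, (s, i) ∈ x.dom) (ha : x.val a i ∈ (idealSystem C F M N₀).C) :
    FlowStep C F M N₀ (x.val a i) (b - a) (x.val b i) := by
  have hint : Ioo a b ⊆ interior (x.flowTimes i) :=
    interior_maximal (fun s hs => hdom s (Ioo_subset_Icc_self hs)) isOpen_Ioo
  have hac := x.absolutelyContinuous i a b hab hdom
  have hflow := hx.flow i
  obtain ⟨c, hc⟩ := (LipschitzWith.prod_snd.comp_absolutelyContinuousOnInterval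
    hac).const_of_ae_hasDerivAt_zero (by
      have hna : ∀ᵐ s : ℝ, s ≠ a := Measure.ae_ne volume a
      have hnb : ∀ᵐ s : ℝ, s ≠ b := Measure.ae_ne volume b
      filter_upwards [hflow, hna, hnb] with s hs hsa hsb hsab
      rw [uIcc_of_le hab] at hsab
      obtain ⟨v, ⟨-, hv1, hv2⟩, hd⟩ :=
        hs (hint ⟨lt_of_le_of_ne hsab.1 hsa.symm, lt_of_le_of_ne hsab.2 hsb⟩)
      have := hasFDerivAt_snd.comp_hasDerivAt s hd
      have hv : v.2 = 0 := Prod.ext hv1 hv2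
      rw [ContinuousLinearMap.coe_snd', hv] at this
      exact this)
  rw [uIcc_of_le hab] at hc
  have hsnd : ∀ s ∈ Icc a b, (x.val s i).2 = (x.val a i).2 := fun s hs =>
    (hc s hs).trans (hc a ⟨le_rfl, hab⟩).symm
  obtain ⟨haC, ⟨σ, h1, hM, hσ⟩, hτ⟩ := ha
  have hcont : ContinuousOn (fun s => (x.val s i).1) (Icc a b) := by
    have := hac.continuousOn
    rw [uIcc_of_le hab] at this
    exact continuous_fst.comp_continuousOn this
  -- Solutions are constrained to the flow set only at interior times; closedness of `C` adds the
  -- endpoints, and `ha` covers a degenerate interval.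
  have hmem : ∀ s ∈ Icc a b, (x.val s i).1 ∈ C := by
    rcases hab.eq_or_lt with rfl | hlt
    · intro s hs
      obtain rfl : s = a := by simpa using hs
      exact haC
    · have hm : MapsTo (fun s => (x.val s i).1) (Ioo a b) C := fun s hs =>
        (hx.flow_mem i s (hint hs)).1
      have := hm.closure_of_continuousOn (by rwa [closure_Ioo hlt.ne])
      rwa [closure_Ioo hlt.ne, hC.closure_eq] at this
  have hderiv : ∀ᵐ s : ℝ, s ∈ Ioo a b →
      ∃ v ∈ F σ (x.val s i).1, HasDerivAt (fun s => (x.val s i).1) v s := by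
    filter_upwards [hflow] with s hs hsab
    obtain ⟨v, ⟨⟨σ', -, -, hσ', hv⟩, -⟩, hd⟩ := hs (hint hsab)
    rw [hsnd s (Ioo_subset_Icc_self hsab), hσ, Nat.cast_inj] at hσ'
    subst hσ'
    have := hasFDerivAt_fst.comp_hasDerivAt s hd
    exact ⟨v.1, hv, this⟩
  obtain ⟨L, hL⟩ := (hF σ ⟨h1, hM⟩).exists_norm_le (isCompact_Icc.image_of_continuousOn hcont)
    (image_subset_iff.2 hmem)
  have hlip := (LipschitzWith.prod_fst.comp_absolutelyContinuousOnInterval hac).lipschitzOnWith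
    (L := L) hab (by
      filter_upwards [hderiv] with s hs hsab
      obtain ⟨v, hv, hd⟩ := hs hsab
      exact ⟨v, hL _ (mem_image_of_mem _ (Ioo_subset_Icc_self hsab)) v hv, hd⟩)
  refine ⟨σ, ⟨h1, hM⟩, hσ, hτ, hsnd b ⟨hab, le_rfl⟩, fun s => (x.val (a + s) i).1,
    ⟨sub_nonneg.2 hab, ⟨L, LipschitzOnWith.of_dist_le_mul fun s hs r hr => ?_⟩, fun s hs => ?_, ?_⟩,
    by simp, by simp⟩
  · have := hlip.dist_le_mul (a + s) ⟨by linarith [hs.1], by linarith [hs.2]⟩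
      (a + r) ⟨by linarith [hr.1], by linarith [hr.2]⟩
    simpa using this
  · exact hmem _ ⟨by linarith [hs.1], by linarith [hs.2]⟩
  · have := (measurePreserving_add_left volume a).quasiMeasurePreserving.ae hderiv
    filter_upwards [this] with s h hs
    obtain ⟨v, hv, hd⟩ := h ⟨by linarith [hs.1], by linarith [hs.2]⟩
    exact ⟨v, hv, hd.comp_const_add a s⟩

theorem HybridSystem.IsSolution.chainReach (hC : IsClosed C)
    (hF : ∀ σ ∈ Icc 1 M, LocallyBoundedRel (F σ) C) {x : HybridArc (E × ℝ × ℝ)}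
    (hx : (idealSystem C F M N₀).IsSolution x) {t : ℝ} {j : ℕ} (htj : (t, j) ∈ x.dom) :
    ChainReach C F M N₀ j (x.val 0 0) t (x.val t j) := by
  obtain ⟨J, θ, hθ0, hθ, hE⟩ := x.isHybridTimeDomain.2 _ htj
  have hmem : ∀ s i, (i ≤ J ∧ θ i ≤ s ∧ s ≤ θ (i + 1)) ↔
      (s, i) ∈ x.dom ∧ 0 ≤ s ∧ s ≤ t ∧ i ≤ j := fun s i => (Set.ext_iff.1 hE (s, i)).symm
  have h00 : 0 ≤ t := by
    have := (hmem 0 0).1 ⟨Nat.zero_le _, by simp [hθ0], by simpa [hθ0] using hθ (Nat.zero_le 1)⟩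
    exact this.2.2.1
  obtain ⟨hjJ, hjt, htj'⟩ := (hmem t j).2 ⟨htj, h00, le_rfl, le_rfl⟩
  have hdom : ∀ i ≤ j, ∀ s ∈ Icc (θ i) (θ (i + 1)), (s, i) ∈ x.dom := fun i hi s hs =>
    ((hmem s i).1 ⟨hi.trans hjJ, hs.1, hs.2⟩).1
  -- The time `θ (i + 1)` ends the `i`-th interval and begins the next one, so both points lie in
  -- the domain.
  have hjump : ∀ i, i + 1 ≤ j → JumpStep C F M N₀ (x.val (θ (i + 1)) i)
      (x.val (θ (i + 1)) (i + 1)) := fun i hi =>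
    hx.jump _ i (hdom i (by omega) _ ⟨hθ (by omega), le_rfl⟩)
      (hdom (i + 1) hi _ ⟨le_rfl, hθ (by omega)⟩)
  have hstart : ∀ i ≤ j, x.val (θ i) i ∈ (idealSystem C F M N₀).C := by
    rintro (_ | i) hi
    · rw [hθ0]
      rcases hx.init with h | h
      · rwa [(isClosed_idealSystem_C hC).closure_eq] at h
      · exact idealSystem_D_subset h
    · exact (hjump i hi).mem_C
  have key : ∀ i ≤ j, ∀ s ∈ Icc (θ i) (θ (i + 1)),
      ChainReach C F M N₀ i (x.val 0 0) s (x.val s i) := by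
    intro i
    induction i with
    | zero =>
      intro hi s hs
      have := hx.flowStep hC hF hs.1
        (fun r hr => hdom 0 hi r ⟨hr.1, hr.2.trans hs.2⟩) (hstart 0 hi)
      rwa [hθ0, sub_zero] at this
    | succ i ih =>
      intro hi s hs
      exact ⟨θ (i + 1), _, _, ih (by omega) _ ⟨hθ (by omega), le_rfl⟩, hjump i hi,
        hx.flowStep hC hF hs.1 (fun r hr => hdom (i + 1) hi r ⟨hr.1, hr.2.trans hs.2⟩)
          (hstart (i + 1) hi)⟩
  exact key j le_rfl t ⟨hjt, htj'⟩

end SolutionToChain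

/-! ### From chains to hybrid solutions -/

section ChainToSolution

variable {X : Type*} [NormedAddCommGroup X] [NormedSpace ℝ X]

/-- `f` flows along the hybrid system `H` on `[a, b]`. -/
structure HybridSystem.FlowsOn (H : HybridSystem X) (f : ℝ → X) (a b : ℝ) : Prop where
  le : a ≤ b
  absolutelyContinuous : AbsolutelyContinuousOnInterval f a b
  mem : ∀ s ∈ Icc a b, f s ∈ H.C
  deriv : ∀ᵐ s : ℝ, s ∈ Ioo a b → ∃ w ∈ H.F (f s), HasDerivAt f w s

theorem HybridSystem.exists_solution_of_flowsOn (H : HybridSystem X) {j : ℕ} {θ : ℕ → ℝ}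
    {v : ℕ → ℝ → X} (h0 : θ 0 = 0) (hv : ∀ i ≤ j, H.FlowsOn (v i) (θ i) (θ (i + 1)))
    (hjump : ∀ i < j, v i (θ (i + 1)) ∈ H.D ∧ v (i + 1) (θ (i + 1)) ∈ H.G (v i (θ (i + 1)))) :
    ∃ x ∈ H.solutions {v 0 0}, (θ (j + 1), j) ∈ x.dom ∧ x.val (θ (j + 1)) j = v j (θ (j + 1)) := by
  have hle : ∀ a b, a ≤ b → b ≤ j + 1 → θ a ≤ θ b := by
    intro a b hab
    induction b, hab using Nat.le_induction with
    | base => exact fun _ => le_rfl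
    | succ b hab ih => exact fun hb => (ih (by omega)).trans (hv b (by omega)).le
  have hft : ∀ i ≤ j, {s : ℝ | (s, i) ∈ {p : ℝ × ℕ | p.2 ≤ j ∧ θ p.2 ≤ p.1 ∧ p.1 ≤ θ (p.2 + 1)}} =
      Icc (θ i) (θ (i + 1)) := fun i hi => by
    ext s
    simp [hi]
  have hft' : ∀ i, ¬ i ≤ j →
      {s : ℝ | (s, i) ∈ {p : ℝ × ℕ | p.2 ≤ j ∧ θ p.2 ≤ p.1 ∧ p.1 ≤ θ (p.2 + 1)}} = ∅ :=
    fun i hi => by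
      ext s
      simp [hi]
  refine ⟨⟨{p | p.2 ≤ j ∧ θ p.2 ≤ p.1 ∧ p.1 ≤ θ (p.2 + 1)}, fun s i => v i s, ⟨⟨(0, 0), ?_⟩, ?_⟩, ?_⟩,
    ⟨⟨?_, ?_, ?_, ?_⟩, rfl⟩, ⟨le_rfl, (hv j le_rfl).le, le_rfl⟩, rfl⟩
  · exact ⟨Nat.zero_le _, h0.le, h0 ▸ hle 0 1 (by omega) (by omega)⟩
  · rintro ⟨p, k⟩ ⟨hk, hp1, hp2⟩
    dsimp only at hk hp1 hp2
    have hp0 : 0 ≤ p := h0 ▸ (hle 0 k (by omega) (by omega)).trans hp1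
    -- Nothing is known of `θ` beyond `j + 1`, so the index is clamped to keep the sequence
    -- monotone; the infimum with `p` truncates the domain at the given point.
    refine ⟨k, fun i => θ (min i (j + 1)) ⊓ p, by simpa [h0] using hp0, ?_, ?_⟩
    · intro a b hab
      exact inf_le_inf_right _ (hle _ _ (min_le_min_right _ hab) (min_le_right _ _))
    · ext ⟨s, i⟩
      simp only [mem_inter_iff, mem_ofPred_eq]
      constructor
      · rintro ⟨⟨h1, h2, h3⟩, h4, h5, h6⟩
        have e1 : min i (j + 1) = i := by omega
        have e2 : min (i + 1) (j + 1) = i + 1 := by omega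
        rw [e1, e2]
        exact ⟨h6, inf_le_left.trans h2, le_inf h3 h5⟩
      · rintro ⟨h1, h2, h3⟩
        have e1 : min i (j + 1) = i := by omega
        have e2 : min (i + 1) (j + 1) = i + 1 := by omega
        rw [e1] at h2
        rw [e2] at h3
        have h4 : θ i ≤ p := (hle i k h1 (by omega)).trans hp1
        rw [inf_eq_left.2 h4] at h2
        exact ⟨⟨by omega, h2, h3.trans inf_le_left⟩,
          h0 ▸ (hle 0 i (by omega) (by omega)).trans h2, h3.trans inf_le_right, h1⟩
  · intro i a b hab h
    obtain ⟨hi, ha, -⟩ := h a ⟨le_rfl, hab⟩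
    obtain ⟨-, -, hb⟩ := h b ⟨hab, le_rfl⟩
    refine (hv i hi).absolutelyContinuous.mono ?_
    rw [uIcc_of_le hab, uIcc_of_le (hv i hi).le]
    exact Icc_subset_Icc ha hb
  · refine .inl (subset_closure ((hv 0 (Nat.zero_le _)).mem 0 ?_))
    exact ⟨h0.le, h0 ▸ hle 0 1 (by omega) (by omega)⟩
  · intro i s hs
    by_cases hi : i ≤ j
    · rw [HybridArc.flowTimes, hft i hi] at hs
      exact (hv i hi).mem s (interior_subset hs)
    · rw [HybridArc.flowTimes, hft' i hi] at hs
      simp at hs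
  · intro i
    by_cases hi : i ≤ j
    · rw [HybridArc.flowTimes, hft i hi, interior_Icc]
      exact (hv i hi).deriv
    · rw [HybridArc.flowTimes, hft' i hi]
      simp
  · rintro s i ⟨-, -, h1⟩ ⟨hi, h2, -⟩
    obtain rfl : s = θ (i + 1) := le_antisymm h1 h2
    exact hjump i hi

variable {E : Type*} [NormedAddCommGroup E] [NormedSpace ℝ E]
  {C : Set E} {F : ℕ → E → Set E} {M N₀ : ℕ} {x y : E × ℝ × ℝ} {t : ℝ}

theorem FlowStep.exists_flowsOn (h : FlowStep C F M N₀ x t y) (a : ℝ) :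
    ∃ f, (idealSystem C F M N₀).FlowsOn f a (a + t) ∧ f a = x ∧ f (a + t) = y := by
  obtain ⟨σ, hσ, hxσ, hτ, hyx, u, hu, hu0, hut⟩ := h
  have hat : a ≤ a + t := le_add_of_nonneg_right hu.nonneg
  refine ⟨fun s => (u (s - a), x.2), ⟨hat, ?_, ?_, ?_⟩, ?_, ?_⟩
  · obtain ⟨L, hL⟩ := hu.lipschitz
    refine LipschitzOnWith.absolutelyContinuousOnInterval (K := L) ?_
    rw [uIcc_of_le hat]
    refine LipschitzOnWith.of_dist_le_mul fun s hs r hr => ?_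
    have := hL.dist_le_mul (s - a) ⟨by linarith [hs.1], by linarith [hs.2]⟩
      (r - a) ⟨by linarith [hr.1], by linarith [hr.2]⟩
    rw [dist_sub_right] at this
    rw [Prod.dist_eq, dist_self, max_eq_left dist_nonneg]
    exact this
  · intro s hs
    exact ⟨hu.mem _ ⟨by linarith [hs.1], by linarith [hs.2]⟩, ⟨σ, hσ.1, hσ.2, hxσ⟩, hτ⟩
  · have := (measurePreserving_sub_right volume a).quasiMeasurePreserving.ae hu.deriv
    filter_upwards [this] with s h hs
    obtain ⟨v, hv, hd⟩ := h ⟨by linarith [hs.1], by linarith [hs.2]⟩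
    exact ⟨(v, 0), ⟨⟨σ, hσ.1, hσ.2, hxσ, hv⟩, rfl, rfl⟩,
      (hd.comp_sub_const s a).prodMk (hasDerivAt_const s x.2)⟩
  · simp [hu0]
  · simp [hut, ← hyx]

theorem ChainReach.exists_flowsOn {j : ℕ} (h : ChainReach C F M N₀ j x t y) :
    ∃ (θ : ℕ → ℝ) (v : ℕ → ℝ → E × ℝ × ℝ), θ 0 = 0 ∧ θ (j + 1) = t ∧ v 0 0 = x ∧ v j t = y ∧
      (∀ i ≤ j, (idealSystem C F M N₀).FlowsOn (v i) (θ i) (θ (i + 1))) ∧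
      ∀ i < j, JumpStep C F M N₀ (v i (θ (i + 1))) (v (i + 1) (θ (i + 1))) := by
  induction j generalizing t y with
  | zero =>
    obtain ⟨f, hf, hf0, hft⟩ := FlowStep.exists_flowsOn h 0
    rw [zero_add] at hf hft
    exact ⟨fun k => if k = 0 then 0 else t, fun _ => f, by simp, by simp, hf0, hft,
      fun i hi => by simpa [Nat.le_zero.1 hi] using hf, by simp⟩
  | succ j ih =>
    obtain ⟨s, x', x'', h1, h2, h3⟩ := h
    obtain ⟨θ, v, hθ0, hθ, hv0, hvj, hv, hvJ⟩ := ih h1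
    obtain ⟨f, hf, hfs, hft⟩ := h3.exists_flowsOn s
    rw [add_sub_cancel] at hf hft
    refine ⟨fun k => if k ≤ j + 1 then θ k else t, fun i => if i ≤ j then v i else f,
      by simpa using hθ0, by simp, by simpa using hv0, by simpa using hft, ?_, ?_⟩
    · intro i hi
      rcases hi.eq_or_lt with rfl | hlt
      · simpa [hθ] using hf
      · have hij : i ≤ j := by omega
        have hij' : i ≤ j + 1 := by omega
        simpa [hij, hij'] using hv i hij
    · intro i hi
      have hij : i ≤ j := by omega
      rcases hij.eq_or_lt with rfl | hlt
      · simpa [hθ, hvj, hfs] using h2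
      · have hij' : i + 1 ≤ j := by omega
        simpa [hij, hij'] using hvJ i hlt

theorem ChainReach.exists_solution {j : ℕ} (h : ChainReach C F M N₀ j x t y) :
    ∃ w ∈ (idealSystem C F M N₀).solutions {x}, (t, j) ∈ w.dom ∧ w.val t j = y := by
  obtain ⟨θ, v, hθ0, rfl, rfl, rfl, hv, hvJ⟩ := h.exists_flowsOn
  exact (idealSystem C F M N₀).exists_solution_of_flowsOn hθ0 hv hvJ

theorem mem_reachable_idealSystem_iff (hC : IsClosed C)
    (hF : ∀ σ ∈ Icc 1 M, LocallyBoundedRel (F σ) C) {K : Set (E × ℝ × ℝ)} :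
    y ∈ (idealSystem C F M N₀).reachable K ↔ ∃ x ∈ K, ∃ t j, ChainReach C F M N₀ j x t y := by
  constructor
  · rintro ⟨w, ⟨hw, hwK⟩, t, j, htj, rfl⟩
    exact ⟨_, hwK, t, j, hw.chainReach hC hF htj⟩
  · rintro ⟨x, hx, t, j, h⟩
    obtain ⟨w, ⟨hw, hw0⟩, htj, hval⟩ := h.exists_solution
    exact ⟨w, ⟨hw, by rwa [mem_singleton_iff.1 hw0]⟩, t, j, htj, hval⟩

theorem mem_omegaLimitSet_idealSystem_iff (hC : IsClosed C)
    (hF : ∀ σ ∈ Icc 1 M, LocallyBoundedRel (F σ) C) {K : Set (E × ℝ × ℝ)} :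
    y ∈ (idealSystem C F M N₀).omegaLimitSet K ↔
      ∃ (x : ℕ → E × ℝ × ℝ) (t : ℕ → ℝ) (j : ℕ → ℕ) (w : ℕ → E × ℝ × ℝ),
        (∀ i, x i ∈ K ∧ ChainReach C F M N₀ (j i) (x i) (t i) (w i)) ∧
        Tendsto (fun i => t i + (j i : ℝ)) atTop atTop ∧ Tendsto w atTop (𝓝 y) := by
  constructor
  · rintro ⟨x, t, j, h, hlim, hy⟩
    exact ⟨fun i => (x i).val 0 0, t, j, _, fun i => ⟨(h i).1.2, (h i).1.1.chainReach hC hF (h i).2⟩,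
      hlim, hy⟩
  · rintro ⟨x, t, j, w, h, hlim, hy⟩
    choose v hv hdom hval using fun i => (h i).2.exists_solution
    refine ⟨v, t, j, fun i => ⟨⟨(hv i).1, ?_⟩, hdom i⟩, hlim, by simpa only [hval] using hy⟩
    rw [mem_singleton_iff.1 (hv i).2]
    exact (h i).1

end ChainToSolution

/-! ### Limits of chains and the two inclusions -/

section ChainLimits

variable {E : Type*} [NormedAddCommGroup E] {C : Set E} {F : ℕ → E → Set E} {M N₀ : ℕ} {zstar : ℕ → E}
  {ι : Type*} {U : Ultrafilter ι} {x y : ι → E × ℝ × ℝ} {t : ι → ℝ} {x₀ y₀ : E × ℝ × ℝ} {t₀ : ℝ}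

/-- A jump fixes `z`, and the new mode and timer are bounded by `M` and `N₀`; thus bounds propagate
across jumps. -/
theorem JumpStep.norm_le {x y : E × ℝ × ℝ} (h : JumpStep C F M N₀ x y) :
    ‖y‖ ≤ ‖x‖ + M + N₀ := by
  obtain ⟨-, ⟨σ, -, hσ, h2⟩, h3⟩ := h.mem_C
  have h1 : y.1 = x.1 := h.2.1
  have hM : (0 : ℝ) ≤ M := Nat.cast_nonneg M
  have hN : (0 : ℝ) ≤ N₀ := Nat.cast_nonneg N₀
  have hσ' : (σ : ℝ) ≤ M := by exact_mod_cast hσ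
  have hx := norm_nonneg x
  refine norm_prod_le_iff.2 ⟨?_, norm_prod_le_iff.2 ⟨?_, ?_⟩⟩
  · rw [h1]
    linarith [norm_fst_le x]
  · rw [h2, Real.norm_of_nonneg (Nat.cast_nonneg σ)]
    linarith
  · rw [Real.norm_of_nonneg h3.1]
    linarith [h3.2]

theorem Ultrafilter.eventually_eq_of_mem_finite {α : Type*} [TopologicalSpace α] [T2Space α]
    {S : Set α} (hS : S.Finite) {f : ι → α} (hf : ∀ᶠ i in U, f i ∈ S) {a : α}
    (ha : Tendsto f U (𝓝 a)) : ∀ᶠ i in U, f i = a := by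
  obtain ⟨b, -, hb⟩ := (Ultrafilter.eventually_exists_mem_iff (P := fun b i => f i = b) hS).1
    (hf.mono fun i hi => ⟨f i, hi, rfl⟩)
  obtain rfl : a = b := tendsto_nhds_unique ha (tendsto_const_nhds.congr' (hb.mono fun _ h => h.symm))
  exact hb

/-- The condition `σ⁺ ≠ σ` is not closed in general, but modes lie in a finite set and hence are
eventually equal to their limits. -/
theorem JumpStep.of_tendsto (hC : IsClosed C) (h : ∀ᶠ i in U, JumpStep C F M N₀ (x i) (y i))
    (hx : Tendsto x U (𝓝 x₀)) (hy : Tendsto y U (𝓝 y₀)) : JumpStep C F M N₀ x₀ y₀ := by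
  have hx1 := (continuous_fst.tendsto _).comp hx
  have hx2 := (continuous_snd.fst.tendsto _).comp hx
  have hx3 := (continuous_snd.snd.tendsto _).comp hx
  have hy1 := (continuous_fst.tendsto _).comp hy
  have hy2 := (continuous_snd.fst.tendsto _).comp hy
  have hy3 := (continuous_snd.snd.tendsto _).comp hy
  have hxe := Ultrafilter.eventually_eq_of_mem_finite (finite_modeSet M)
    (h.mono fun i hi => hi.1.2.1) hx2
  have hye := Ultrafilter.eventually_eq_of_mem_finite (finite_modeSet M)
    (h.mono fun i hi => hi.2.2.1.1) hy2
  refine ⟨(isClosed_idealSystem_D hC).mem_of_tendsto hx (h.mono fun i hi => hi.1), ?_, ?_, ?_⟩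
  · exact tendsto_nhds_unique_of_eventuallyEq hy1 hx1 (h.mono fun i hi => hi.2.1)
  · obtain ⟨i, hi, hxi, hyi⟩ := (h.and (hxe.and hye)).exists
    rw [← hxi, ← hyi]
    exact hi.2.2.1
  · exact tendsto_nhds_unique_of_eventuallyEq hy3 (hx3.sub_const 1) (h.mono fun i hi => hi.2.2.2)

variable [NormedSpace ℝ E]

/-- With finitely many modes, the ultrafilter selects one shared by almost all steps. -/
theorem FlowStep.exists_mode (h : ∀ᶠ i in U, FlowStep C F M N₀ (x i) (t i) (y i)) :
    ∃ σ ∈ Icc 1 M, ∃ u : ι → ℝ → E, ∀ᶠ i in U, (x i).2.1 = (σ : ℝ) ∧ (x i).2.2 ∈ Icc (0 : ℝ) N₀ ∧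
      (y i).2 = (x i).2 ∧ IsFlow C (F σ) (u i) (t i) ∧ u i 0 = (x i).1 ∧ u i (t i) = (y i).1 := by
  obtain ⟨σ, hσ, h⟩ := (Ultrafilter.eventually_exists_mem_iff (finite_Icc 1 M)).1 h
  refine ⟨σ, hσ, ?_⟩
  have h' : ∀ᶠ i in U, ∃ u, (x i).2.1 = (σ : ℝ) ∧ (x i).2.2 ∈ Icc (0 : ℝ) N₀ ∧
      (y i).2 = (x i).2 ∧ IsFlow C (F σ) u (t i) ∧ u 0 = (x i).1 ∧ u (t i) = (y i).1 := by
    filter_upwards [h] with i ⟨h1, h2, h3, u, h4⟩ using ⟨u, h1, h2, h3, h4⟩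
  exact h'.choice

theorem ChainReach.prepend_const {j : ℕ} {σ : ℕ} {x y : E × ℝ × ℝ} {t : ℝ}
    (h : ChainReach C F M N₀ j x t y) (hxσ : x.2.1 = (σ : ℝ)) (h0 : (0 : E) ∈ F σ x.1) {a : ℝ}
    (ha : 0 ≤ a) : ChainReach C F M N₀ j x (a + t) y := by
  induction j generalizing t y with
  | zero =>
    obtain ⟨σ', hσ', h1, h2, h3, u, hu, hu0, hut⟩ := h
    obtain rfl : σ = σ' := by exact_mod_cast hxσ.symm.trans h1
    refine ⟨σ, hσ', h1, h2, h3, _, hu.prepend_const (hu0 ▸ h0) ha, ?_, ?_⟩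
    · rwa [max_eq_left (by linarith)]
    · rwa [add_sub_cancel_left, max_eq_right hu.nonneg]
  | succ j ih =>
    obtain ⟨s, x', x'', h1, h2, h3⟩ := h
    refine ⟨a + s, x', x'', ih h1, h2, ?_⟩
    rwa [add_sub_add_left_eq_sub]

/-- The constant solution satisfies the reversed inclusion at some time in `(0, 1)`, where its
derivative can only be zero. -/
theorem BackwardUnique.zero_mem {C : Set E} {F : E → Set E} {z : E} (h : BackwardUnique C F z) :
    (0 : E) ∈ F z := by
  obtain ⟨⟨x, ⟨hx, -⟩, hdom, hval⟩, -⟩ := h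
  obtain ⟨t, ht, ht1⟩ := (Measure.dense_of_ae (hx.flow 0)).exists_mem_open isOpen_Ioo
    (nonempty_Ioo.2 (zero_lt_one' ℝ))
  have hI : Ioi 0 ⊆ x.flowTimes 0 := fun s hs => by
    rw [HybridArc.flowTimes, hdom]
    exact ⟨(mem_Ioi.1 hs).le, rfl⟩
  obtain ⟨v, hv, hd⟩ := ht (interior_maximal hI isOpen_Ioi ht1.1)
  have he : (fun s => x.val s 0) =ᶠ[𝓝 t] fun _ => z := by
    filter_upwards [Ioi_mem_nhds ht1.1] with s hs using hval s (mem_Ioi.1 hs).le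
  have h0 : v = 0 := hd.unique ((hasDerivAt_const t z).congr_of_eventuallyEq he)
  have hv' : -v ∈ F (x.val t 0) := hv
  rwa [hval t ht1.1.le, h0, neg_zero] at hv'

variable [FiniteDimensional ℝ E]

theorem FlowStep.exists_norm_le (hC : IsClosed C)
    (hF : ∀ σ ∈ Icc 1 M, RegularWithGASPoint C (F σ) (zstar σ))
    (h : ∀ᶠ i in U, FlowStep C F M N₀ (x i) (t i) (y i)) {B R₀ : ℝ} (ht : ∀ᶠ i in U, t i ≤ B)
    (hx : ∀ᶠ i in U, ‖x i‖ ≤ R₀) : ∃ R, ∀ᶠ i in U, ‖y i‖ ≤ R := by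
  obtain ⟨σ, hσ, u, hu⟩ := FlowStep.exists_mode h
  obtain ⟨R, hR⟩ := (hF σ hσ).exists_forall_norm_le hC (hu.mono fun i hi => hi.2.2.2.1) ht
    (R₀ := R₀) (by
      filter_upwards [hu, hx] with i hi hix
      rw [hi.2.2.2.2.1]
      exact (norm_fst_le _).trans hix)
  refine ⟨max R R₀, ?_⟩
  filter_upwards [hu, hx, hR] with i ⟨_, _, hy, hfl, _, hyt⟩ hix hiR
  refine norm_prod_le_iff.2 ⟨?_, ?_⟩
  · rw [← hyt]
    exact (hiR _ ⟨hfl.nonneg, le_rfl⟩).trans (le_max_left _ _)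
  · rw [hy]
    exact ((norm_snd_le _).trans hix).trans (le_max_right _ _)

theorem FlowStep.of_tendsto (hC : IsClosed C)
    (hF : ∀ σ ∈ Icc 1 M, RegularWithGASPoint C (F σ) (zstar σ))
    (h : ∀ᶠ i in U, FlowStep C F M N₀ (x i) (t i) (y i)) (hx : Tendsto x U (𝓝 x₀))
    (ht : Tendsto t U (𝓝 t₀)) (hy : Tendsto y U (𝓝 y₀)) : FlowStep C F M N₀ x₀ t₀ y₀ := by
  obtain ⟨σ, hσ, u, hu⟩ := FlowStep.exists_mode h
  have hx1 := (continuous_fst.tendsto _).comp hx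
  have hx2 := (continuous_snd.tendsto _).comp hx
  have hx3 := (continuous_snd.snd.tendsto _).comp hx
  have hy1 := (continuous_fst.tendsto _).comp hy
  have hy2 := (continuous_snd.tendsto _).comp hy
  obtain ⟨v, hv, hv0, hvt⟩ := (hF σ hσ).exists_isFlow_of_tendsto hC
    (hu.mono fun i hi => hi.2.2.2.1) ht
    (hx1.congr' (hu.mono fun i hi => hi.2.2.2.2.1.symm))
    (hy1.congr' (hu.mono fun i hi => hi.2.2.2.2.2.symm))
  refine ⟨σ, hσ, ?_, isClosed_Icc.mem_of_tendsto hx3 (hu.mono fun i hi => hi.2.1), ?_,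
    v, hv, hv0, hvt⟩
  · exact tendsto_nhds_unique_of_eventuallyEq ((continuous_fst.tendsto _).comp hx2)
      tendsto_const_nhds (hu.mono fun i hi => hi.1)
  · exact tendsto_nhds_unique_of_eventuallyEq hy2 hx2 (hu.mono fun i hi => hi.2.2.1)

/-- Long flows from a bounded set pass close to the equilibrium of their mode. -/
theorem FlowStep.exists_near (hC : IsClosed C)
    (hF : ∀ σ ∈ Icc 1 M, RegularWithGASPoint C (F σ) (zstar σ))
    (h : ∀ᶠ i in U, FlowStep C F M N₀ (x i) (t i) (y i)) (ht : Tendsto t U atTop) {R₀ : ℝ}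
    (hx : ∀ᶠ i in U, ‖x i‖ ≤ R₀) : ∃ σ ∈ Icc 1 M, ∀ ε > 0, ∀ᶠ i in U,
      ∃ w ∈ Metric.closedBall (zstar σ) ε ×ˢ {(σ : ℝ)} ×ˢ Icc (0 : ℝ) N₀, ∃ s,
        FlowStep C F M N₀ w s (y i) := by
  obtain ⟨σ, hσ, u, hu⟩ := FlowStep.exists_mode h
  refine ⟨σ, hσ, fun ε hε => ?_⟩
  obtain ⟨s, hs, hnear⟩ := (hF σ hσ).exists_eventually_norm_sub_lt hC
    (hu.mono fun i hi => hi.2.2.2.1) ht (R₀ := R₀) (by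
      filter_upwards [hu, hx] with i hi hix
      rw [hi.2.2.2.2.1]
      exact (norm_fst_le _).trans hix) hε
  filter_upwards [hu, hnear] with i ⟨h1, h2, h3, hfl, _, hyt⟩ ⟨hst, hlt⟩
  refine ⟨(u i s, (x i).2), ⟨?_, h1, h2⟩, t i - s, σ, hσ, h1, h2, h3, _,
    hfl.shift ⟨hs, hst⟩, by simp, by simpa using hyt⟩
  rw [mem_closedBall_iff_norm]
  exact hlt.le

theorem ChainReach.exists_norm_le (hC : IsClosed C)
    (hF : ∀ σ ∈ Icc 1 M, RegularWithGASPoint C (F σ) (zstar σ)) {j : ℕ}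
    (h : ∀ᶠ i in U, ChainReach C F M N₀ j (x i) (t i) (y i)) {B R₀ : ℝ} (ht : ∀ᶠ i in U, t i ≤ B)
    (hx : ∀ᶠ i in U, ‖x i‖ ≤ R₀) : ∃ R, ∀ᶠ i in U, ‖y i‖ ≤ R := by
  induction j generalizing t y with
  | zero => exact FlowStep.exists_norm_le hC hF h ht hx
  | succ j ih =>
    obtain ⟨s, h⟩ := Eventually.choice h
    obtain ⟨x', h⟩ := Eventually.choice h
    obtain ⟨x'', h⟩ := Eventually.choice h
    obtain ⟨R, hR⟩ := ih (h.mono fun i hi => hi.1) (by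
      filter_upwards [h, ht] with i hi hit
      linarith [hi.2.2.nonneg])
    refine FlowStep.exists_norm_le hC hF (h.mono fun i hi => hi.2.2) (B := B)
      (R₀ := R + M + N₀) ?_ ?_
    · filter_upwards [h, ht] with i hi hit
      linarith [hi.1.nonneg]
    · filter_upwards [h, hR] with i hi hiR
      linarith [hi.2.1.norm_le]

theorem ChainReach.of_tendsto (hC : IsClosed C)
    (hF : ∀ σ ∈ Icc 1 M, RegularWithGASPoint C (F σ) (zstar σ)) {j : ℕ}
    (h : ∀ᶠ i in U, ChainReach C F M N₀ j (x i) (t i) (y i)) (hx : Tendsto x U (𝓝 x₀))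
    (ht : Tendsto t U (𝓝 t₀)) (hy : Tendsto y U (𝓝 y₀)) : ChainReach C F M N₀ j x₀ t₀ y₀ := by
  have := FiniteDimensional.proper_real E
  induction j generalizing t y t₀ y₀ with
  | zero => exact FlowStep.of_tendsto hC hF h hx ht hy
  | succ j ih =>
    obtain ⟨s, h⟩ := Eventually.choice h
    obtain ⟨x', h⟩ := Eventually.choice h
    obtain ⟨x'', h⟩ := Eventually.choice h
    have hsB : ∀ᶠ i in U, s i ≤ t₀ + 1 := by
      filter_upwards [h, ht.eventually_le_const (lt_add_one t₀)] with i hi hit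
      linarith [hi.2.2.nonneg]
    obtain ⟨s₀, hs₀⟩ := Ultrafilter.exists_tendsto_of_norm_le (f := s) (U := U) (R := t₀ + 1) (by
      filter_upwards [h, hsB] with i hi hiB
      rwa [Real.norm_of_nonneg hi.1.nonneg])
    obtain ⟨R, hR⟩ := ChainReach.exists_norm_le hC hF (h.mono fun i hi => hi.1) hsB
      hx.eventually_norm_le
    obtain ⟨x₀', hx'⟩ := Ultrafilter.exists_tendsto_of_norm_le hR
    obtain ⟨x₀'', hx''⟩ := Ultrafilter.exists_tendsto_of_norm_le (f := x'') (U := U)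
      (R := R + M + N₀) (by
        filter_upwards [h, hR] with i hi hiR
        linarith [hi.2.1.norm_le])
    exact ⟨s₀, x₀', x₀'', ih (h.mono fun i hi => hi.1) hs₀ hx',
      JumpStep.of_tendsto hC (h.mono fun i hi => hi.2.1) hx' hx'',
      FlowStep.of_tendsto hC hF (h.mono fun i hi => hi.2.2) hx'' (ht.sub hs₀) hy⟩

/-- Long chains from a bounded set pass close to one of the equilibria. -/
theorem ChainReach.exists_near (hC : IsClosed C)
    (hF : ∀ σ ∈ Icc 1 M, RegularWithGASPoint C (F σ) (zstar σ)) {j : ℕ}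
    (h : ∀ᶠ i in U, ChainReach C F M N₀ j (x i) (t i) (y i)) (ht : Tendsto t U atTop) {R₀ : ℝ}
    (hx : ∀ᶠ i in U, ‖x i‖ ≤ R₀) : ∃ σ ∈ Icc 1 M, ∀ ε > 0, ∀ᶠ i in U,
      ∃ w ∈ Metric.closedBall (zstar σ) ε ×ˢ {(σ : ℝ)} ×ˢ Icc (0 : ℝ) N₀, ∃ s k,
        ChainReach C F M N₀ k w s (y i) := by
  induction j generalizing t y with
  | zero =>
    obtain ⟨σ, hσ, hnear⟩ := FlowStep.exists_near hC hF h ht hx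
    exact ⟨σ, hσ, fun ε hε => (hnear ε hε).mono fun i ⟨w, hw, s, hs⟩ => ⟨w, hw, s, 0, hs⟩⟩
  | succ j ih =>
    obtain ⟨s, h⟩ := Eventually.choice h
    obtain ⟨x', h⟩ := Eventually.choice h
    obtain ⟨x'', h⟩ := Eventually.choice h
    -- If the time `s` before the last segment is unbounded, the earlier part already passes near an
    -- equilibrium, and the last jump and flow are appended. Otherwise the last segment is the long
    -- one, and it starts in a bounded set.
    rcases Ultrafilter.tendsto_atTop_or_eventually_le (U := U) s with hs | ⟨B, hB⟩
    · obtain ⟨σ, hσ, hnear⟩ := ih (h.mono fun i hi => hi.1) hs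
      refine ⟨σ, hσ, fun ε hε => ?_⟩
      filter_upwards [h, hnear ε hε] with i hi ⟨w, hw, r, k, hk⟩
      refine ⟨w, hw, r + (t i - s i), k + 1, r, _, _, hk, hi.2.1, ?_⟩
      rw [add_sub_cancel_left]
      exact hi.2.2
    · obtain ⟨R, hR⟩ := ChainReach.exists_norm_le hC hF (h.mono fun i hi => hi.1) hB hx
      have hts : Tendsto (fun i => t i - s i) U atTop :=
        tendsto_atTop_mono' _ (hB.mono fun i hi => sub_le_sub_left hi (t i))
          (tendsto_atTop_add_const_right _ (-B) ht)
      obtain ⟨σ, hσ, hnear⟩ := FlowStep.exists_near hC hF (h.mono fun i hi => hi.2.2) hts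
        (R₀ := R + M + N₀) (by
          filter_upwards [h, hR] with i hi hiR
          linarith [hi.2.1.norm_le])
      exact ⟨σ, hσ, fun ε hε => (hnear ε hε).mono fun i ⟨w, hw, s, hs⟩ => ⟨w, hw, s, 0, hs⟩⟩

theorem omegaLimitSet_subset_limitSet (hC : IsClosed C)
    (hF : ∀ σ ∈ Icc 1 M, RegularWithGASPoint C (F σ) (zstar σ)) {K : Set (E × ℝ × ℝ)}
    (hK : Bornology.IsBounded K) :
    (idealSystem C F M N₀).omegaLimitSet K ⊆ limitSet C F M N₀ zstar := by
  have hb : ∀ σ ∈ Icc 1 M, LocallyBoundedRel (F σ) C := fun σ hσ => (hF σ hσ).locallyBounded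
  intro y hy
  obtain ⟨x, t, j, w, h, hlim, hwy⟩ := (mem_omegaLimitSet_idealSystem_iff hC hb).1 hy
  have hU : (hyperfilter ℕ : Filter ℕ) ≤ atTop := Nat.hyperfilter_le_atTop
  -- The jump count takes finitely many values, so it is constant along the ultrafilter; this allows
  -- induction on it.
  obtain ⟨j₀, -, hj⟩ := (Ultrafilter.eventually_exists_mem_iff (f := hyperfilter ℕ)
    (P := fun k i => j i = k) (finite_Iic N₀)).1
    (Eventually.of_forall fun i => ⟨j i, (h i).2.jumps_le, rfl⟩)
  have ht : Tendsto t (hyperfilter ℕ) atTop := by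
    refine tendsto_atTop_mono (fun i => ?_)
      ((tendsto_atTop_add_const_right _ (-(N₀ : ℝ)) hlim).mono_left hU)
    have : (j i : ℝ) ≤ N₀ := by exact_mod_cast (h i).2.jumps_le
    linarith
  obtain ⟨R, hR⟩ := hK.exists_norm_le
  obtain ⟨σ, hσ, hnear⟩ := ChainReach.exists_near hC hF (U := hyperfilter ℕ) (j := j₀) (y := w)
    (hj.mono fun i hi => hi ▸ (h i).2) ht (Eventually.of_forall fun i => hR _ (h i).1)
  refine mem_biUnion hσ (mem_iInter.2 fun n => ?_)
  refine mem_closure_of_tendsto (hwy.mono_left hU) ?_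
  filter_upwards [hnear (1 / ((n : ℝ) + 1)) (by positivity)] with i ⟨v, hv, s, k, hk⟩
  exact (mem_reachable_idealSystem_iff hC hb).2 ⟨v, hv, s, k, hk⟩

theorem limitSet_subset_omegaLimitSet (hC : IsClosed C)
    (hF : ∀ σ ∈ Icc 1 M, RegularWithGASPoint C (F σ) (zstar σ))
    (h0 : ∀ σ ∈ Icc 1 M, (0 : E) ∈ F σ (zstar σ)) {K : Set (E × ℝ × ℝ)}
    (hK : equilibriaSet M N₀ zstar ⊆ interior K) :
    limitSet C F M N₀ zstar ⊆ (idealSystem C F M N₀).omegaLimitSet K := by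
  have hb : ∀ σ ∈ Icc 1 M, LocallyBoundedRel (F σ) C := fun σ hσ => (hF σ hσ).locallyBounded
  intro y hy
  obtain ⟨σ, hσ, hy⟩ := mem_iUnion₂.1 hy
  have hU : (hyperfilter ℕ : Filter ℕ) ≤ atTop := Nat.hyperfilter_le_atTop
  have hzero : Tendsto (fun i : ℕ => 1 / ((i : ℝ) + 1)) atTop (𝓝 0) :=
    tendsto_one_div_add_atTop_nhds_zero_nat
  have hseq : ∀ i : ℕ, ∃ x ∈ Metric.closedBall (zstar σ) (1 / ((i : ℝ) + 1)) ×ˢ {(σ : ℝ)} ×ˢ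
      Icc (0 : ℝ) N₀, ∃ t j w, ChainReach C F M N₀ j x t w ∧ dist y w < 1 / ((i : ℝ) + 1) := by
    intro i
    obtain ⟨w, hw, hd⟩ := Metric.mem_closure_iff.1 (mem_iInter.1 hy i) (1 / ((i : ℝ) + 1))
      (by positivity)
    obtain ⟨x, hx, t, j, h⟩ := (mem_reachable_idealSystem_iff hC hb).1 hw
    exact ⟨x, hx, t, j, w, h, hd⟩
  choose x hx t j w h hd using hseq
  have hwy : Tendsto w (hyperfilter ℕ) (𝓝 y) := by
    refine Tendsto.mono_left ?_ hU
    rw [tendsto_iff_dist_tendsto_zero]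
    refine squeeze_zero (fun _ => dist_nonneg) (fun i => ?_) hzero
    rw [dist_comm]
    exact (hd i).le
  obtain ⟨τ₀, hτ₀, hτ⟩ : ∃ τ₀ ∈ Icc (0 : ℝ) N₀,
      Tendsto (fun i => (x i).2.2) (hyperfilter ℕ) (𝓝 τ₀) := by
    obtain ⟨τ₀, hτ⟩ := Ultrafilter.exists_tendsto_of_norm_le (f := fun i => (x i).2.2)
      (U := hyperfilter ℕ) (R := N₀) (Eventually.of_forall fun i => by
        rw [Real.norm_of_nonneg (hx i).2.2.1]
        exact (hx i).2.2.2)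
    exact ⟨τ₀, isClosed_Icc.mem_of_tendsto hτ (Eventually.of_forall fun i => (hx i).2.2), hτ⟩
  have hxlim : Tendsto x (hyperfilter ℕ) (𝓝 (zstar σ, (σ : ℝ), τ₀)) := by
    have h2 : Tendsto (fun i => (x i).2.1) (hyperfilter ℕ) (𝓝 (σ : ℝ)) :=
      tendsto_const_nhds.congr fun i => (mem_singleton_iff.1 (hx i).2.1).symm
    have h1 : Tendsto (fun i => (x i).1) (hyperfilter ℕ) (𝓝 (zstar σ)) := by
      refine Tendsto.mono_left ?_ hU
      rw [tendsto_iff_dist_tendsto_zero]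
      exact squeeze_zero (fun _ => dist_nonneg) (fun i => (hx i).1) hzero
    exact h1.prodMk_nhds (h2.prodMk_nhds hτ)
  have hxK : (zstar σ, (σ : ℝ), τ₀) ∈ interior K := hK (mem_biUnion hσ ⟨rfl, rfl, hτ₀⟩)
  have key : ∀ m : ℕ, ∃ x ∈ K, ∃ t j w, ChainReach C F M N₀ j x t w ∧ (m : ℝ) ≤ t ∧
      dist w y ≤ 1 / ((m : ℝ) + 1) := by
    intro m
    rcases Ultrafilter.tendsto_atTop_or_eventually_le (U := hyperfilter ℕ) t with ht | ⟨B, hB⟩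
    · obtain ⟨i, hiK, hit, hid⟩ := ((hxlim.eventually (mem_interior_iff_mem_nhds.1 hxK)).and
        ((tendsto_atTop.1 ht m).and (hwy.eventually (Metric.closedBall_mem_nhds y
          (by positivity : (0 : ℝ) < 1 / ((m : ℝ) + 1)))))).exists
      exact ⟨x i, hiK, t i, j i, w i, h i, hit, hid⟩
    · obtain ⟨t₀, ht₀⟩ := Ultrafilter.exists_tendsto_of_norm_le (f := t) (U := hyperfilter ℕ)
        (R := B) (hB.mono fun i hi => by rwa [Real.norm_of_nonneg (h i).nonneg])
      obtain ⟨j₀, -, hj⟩ := (Ultrafilter.eventually_exists_mem_iff (f := hyperfilter ℕ)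
        (P := fun k i => j i = k) (finite_Iic N₀)).1
        (Eventually.of_forall fun i => ⟨j i, (h i).jumps_le, rfl⟩)
      have hlim := ChainReach.of_tendsto hC hF (j := j₀) (hj.mono fun i hi => hi ▸ h i)
        hxlim ht₀ hwy
      refine ⟨_, interior_subset hxK, m + t₀, j₀, y,
        hlim.prepend_const rfl (h0 σ hσ) (Nat.cast_nonneg m), ?_, ?_⟩
      · linarith [hlim.nonneg]
      · rw [dist_self]
        positivity
  choose x' hx' t' j' w' h' ht' hd' using key
  refine (mem_omegaLimitSet_idealSystem_iff hC hb).2 ⟨x', t', j', w', fun i => ⟨hx' i, h' i⟩, ?_, ?_⟩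
  · refine tendsto_atTop_mono (fun i => ?_) tendsto_natCast_atTop_atTop
    linarith [ht' i, Nat.cast_nonneg (α := ℝ) (j' i)]
  · rw [tendsto_iff_dist_tendsto_zero]
    exact squeeze_zero (fun _ => dist_nonneg) hd' hzero

end ChainLimits

theorem proposition2 (n M N₀ : ℕ) (hM : 0 < M) (hN₀ : 0 < N₀)
    (C : Set (EuclideanSpace ℝ (Fin n))) (hC : IsClosed C)
    (F : ℕ → EuclideanSpace ℝ (Fin n) → Set (EuclideanSpace ℝ (Fin n)))
    (zstar : ℕ → EuclideanSpace ℝ (Fin n))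
    (hF : ∀ σ ∈ Set.Icc 1 M, RegularWithGASPoint C (F σ) (zstar σ))
    (hback : ∀ σ ∈ Set.Icc 1 M, BackwardUnique C (F σ) (zstar σ))
    (K : Set (EuclideanSpace ℝ (Fin n) × ℝ × ℝ)) (hK : IsCompact K)
    (hK₀ : equilibriaSet M N₀ zstar ⊆ interior K) :
    (idealSystem C F M N₀).omegaLimitSet K = limitSet C F M N₀ zstar :=
  (omegaLimitSet_subset_limitSet hC hF hK.isBounded).antisymm
    (limitSet_subset_omegaLimitSet hC hF (fun σ hσ => (hback σ hσ).zero_mem) hK₀)
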